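/- For every integer $k\ge 1$ there is exactly one real $\lambda_k\ge 0$ with $$\Pr[\mathrm{Pois}(\lambda_k)<k]=\frac{\mathbb{E}[\min\{\mathrm{Pois}(\lambda_k),k\}]}{k},$$ and, as $k\to\infty$, this common value satisfies $$\Pr[\mathrm{Pois}(\lambda_k)<k]=\frac{\mathbb{E}[\min\{\mathrm{Pois}(\lambda_k),k\}]}{k}=1-\Theta\Big(\sqrt{\tfrac{\log k}{k}}\Big).$$ Consequently the static-threshold rate $1-O(\sqrt{\log k/k})$ of Hajiaghayi et al. is tight, in the following sense. An instance with $k$ slots consists of $n>k$ agents arriving in the order $1,\dots,n$, valuations $r_1\ge\dots\ge r_m\ge 0$, and probabilities $p_{ij}\ge 0$ with $\sum_{j=1}^m p_{ij}=1$; independently across $i$, agent $i$ has type $j$ and valuation $R_i=r_j$ with probability $p_{ij}$. The static threshold policy with parameters $J\in\{1,\dots,m\}$ and $\rho\in(0,1]$ accepts the first $k$ agents that clear the threshold, where an agent of type $j<J$ always clears, an agent of type $J$ clears with probability $\rho$ by an independent coin flip, and no other agent clears; its reward is the expected sum of the valuations of the accepted agents. For an instance $I$, let $\mathsf{ST}(I)$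 be the supremum of this reward over $(J,\rho)$, let $$\mathsf{Proph}(I)=\mathbb{E}\Big[\max_{S\subseteq\{1,\dots,n\},\,|S|\le k}\sum_{i\in S}R_i\Big],\qquad \mathsf{ExAnte}(I)=\max\Big\{\sum_{j=1}^m r_ja_j:\ \sum_{j=1}^m a_j\le k,\ 0\le a_j\le\sum_{i=1}^n p_{ij}\Big\},$$ and let $\mathsf{B}\in\{\mathsf{Proph},\mathsf{ExAnte}\}$. Let $\alpha^{\mathsf{ST}/\mathsf{B}}_k$ be the supremum of all $\alpha\le 1$ such that $\mathsf{ST}(I)\ge\alpha\,\mathsf{B}(I)$ for every instance $I$ with $k$ slots. Let $\alpha^{\mathsf{OST}/\mathsf{B}}_k$ be the supremum of all $\alpha\le1$ such that for every $n>k$, $m$ and $(p_{ij})$ there are $J,\rho$ for which, for all $r_1\ge\dots\ge r_m\ge0$, the reward of the policy $(J,\rho)$ is at least $\alpha\,\mathsf{B}(I)$ (oblivious static thresholds). Then, as $k\to\infty$, each of the four guarantees $\alpha^{\mathsf{ST}/\mathsf{Proph}}_k$, $\alpha^{\mathsf{ST}/\mathsf{ExAnte}}_k$, $\alpha^{\mathsf{OST}/\mathsf{Proph}}_k$,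 $\alpha^{\mathsf{OST}/\mathsf{ExAnte}}_k$ equals $1-\Theta(\sqrt{\log k/k})$. -/

import Mathlib

open Filter Asymptotics MeasureTheory ProbabilityTheory

open scoped NNReal

noncomputable section

/-- `Pr[Pois(lam) < k]`. -/
def poissonBelow (k : ℕ) (lam : ℝ≥0) : ℝ :=
  (poissonMeasure lam).real {x : ℕ | x < k}

/-- `E[min {Pois(lam), k}] / k`. -/
def poissonFill (k : ℕ) (lam : ℝ≥0) : ℝ :=
  (∫ x : ℕ, min (x : ℝ) (k : ℝ) ∂(poissonMeasure lam)) / k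

/-- Type distributions of `n` independent agents over `m` types:
agent `i` has type `j` with probability `prob i j`. -/
structure TypeDist (n m : ℕ) where
  prob : Fin n → Fin m → ℝ
  prob_nonneg : ∀ i j, 0 ≤ prob i j
  sum_prob : ∀ i, ∑ j, prob i j = 1

/-- Valuations of the `m` types, best type first: `r_1 ≥ ⋯ ≥ r_m ≥ 0`. -/
def IsValuation {m : ℕ} (r : Fin m → ℝ) : Prop :=
  Antitone r ∧ ∀ j, 0 ≤ r j

/-- Probability that the types of the agents are `t 0, t 1, …`. -/
def TypeDist.weight {n m : ℕ} (G : TypeDist n m) (t : Fin n → Fin m) : ℝ :=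
  ∏ i, G.prob i (t i)

/-- The prophet: the expectation of the largest total valuation of at most `k` agents. -/
def prophValue (k : ℕ) {n m : ℕ} (G : TypeDist n m) (r : Fin m → ℝ) : ℝ :=
  ∑ t : Fin n → Fin m, G.weight t *
    (Finset.univ.filter fun S : Finset (Fin n) => S.card ≤ k).sup' ⟨∅, by simp⟩
      (fun S => ∑ i ∈ S, r (t i))

/-- The ex-ante relaxation: the optimal value of the linear program
`max ∑ r_j a_j` subject to `∑ a_j ≤ k` and `0 ≤ a_j ≤ ∑ i, p_{ij}`. -/
def exAnteValue (k : ℕ) {n m : ℕ} (G : TypeDist n m) (r : Fin m → ℝ) : ℝ :=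
  sSup {v : ℝ | ∃ a : Fin m → ℝ, ∑ j, a j ≤ k ∧
    (∀ j, 0 ≤ a j ∧ a j ≤ ∑ i, G.prob i j) ∧ v = ∑ j, r j * a j}

/-- Agent `i` clears the threshold `J`: the type is better than `J`,
or it is exactly `J` and the tie-breaking coin of `i` shows `true`. -/
def Clears {n m : ℕ} (J : Fin m) (t : Fin n → Fin m) (b : Fin n → Bool) (i : Fin n) : Prop :=
  t i < J ∨ (t i = J ∧ b i = true)

open Classical in
/-- Agents accepted when the first `k` agents that clear the threshold are accepted. -/
def acceptedSet (k : ℕ) {n m : ℕ} (J : Fin m) (t : Fin n → Fin m) (b : Fin n → Bool) :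
    Finset (Fin n) :=
  Finset.univ.filter fun i =>
    Clears J t b i ∧ (Finset.univ.filter fun i' => i' < i ∧ Clears J t b i').card < k

/-- Probability of the outcomes `b` of independent tie-breaking coins with bias `ρ`. -/
def coinWeight {n : ℕ} (ρ : ℝ) (b : Fin n → Bool) : ℝ :=
  ∏ i, if b i = true then ρ else 1 - ρ

/-- Expected total valuation collected by the static threshold policy `(J, ρ)`. -/
def staticReward (k : ℕ) {n m : ℕ} (G : TypeDist n m) (r : Fin m → ℝ) (J : Fin m) (ρ : ℝ) : ℝ :=
  ∑ t : Fin n → Fin m, ∑ b : Fin n → Bool,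
    G.weight t * coinWeight ρ b * ∑ i ∈ acceptedSet k J t b, r (t i)

/-- Performance of the best static threshold policy, chosen with full knowledge of the instance. -/
def stValue (k : ℕ) {n m : ℕ} (G : TypeDist n m) (r : Fin m → ℝ) : ℝ :=
  ⨆ x : Fin m × Set.Ioc (0 : ℝ) 1, staticReward k G r x.1 x.2

/-- A benchmark, as a function of the number of slots and the instance. -/
abbrev Benchmark : Type :=
  ℕ → ∀ {n m : ℕ}, TypeDist n m → (Fin m → ℝ) → ℝ

/-- The tight guarantee for static threshold policies with `k` slots relative to a benchmark:
the supremum of the `α ≤ 1` with `ST(I) ≥ α · bench(I)` on all instances `I` with `n > k` agents. -/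
def stGuarantee (bench : Benchmark) (k : ℕ) : ℝ :=
  sSup {α : ℝ | α ≤ 1 ∧ ∀ (n m : ℕ) (G : TypeDist n m) (r : Fin m → ℝ),
    k < n → IsValuation r → α * bench k G r ≤ stValue k G r}

/-- The tight guarantee for oblivious static threshold policies: the threshold `J` and the
tie-break probability `ρ` are fixed knowing the type distributions, before the valuations. -/
def ostGuarantee (bench : Benchmark) (k : ℕ) : ℝ :=
  sSup {α : ℝ | α ≤ 1 ∧ ∀ (n m : ℕ) (G : TypeDist n m), k < n →
    ∃ (J : Fin m) (ρ : ℝ), 0 < ρ ∧ ρ ≤ 1 ∧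
      ∀ r : Fin m → ℝ, IsValuation r → α * bench k G r ≤ staticReward k G r J ρ}

end

/-! Write u = √(log k / k) and X ~ Pois(l). As l grows, the availability Pr[X < k] falls strictly
from 1 to 0 and the fill rate E[min{X,k}]/k rises from 0 to 1, so they cross exactly once. By
monotonicity the crossing value lies between the minimum and the maximum of the two at any test
rate. At l = k(1 - 2u) a Chernoff bound makes both at least 1 - 3u. At l = k(1 - u/8) both are at
most 1 - u/8: the fill rate is at most l/k, and the roughly √k points from k on carry mass at least
k^(-1/8)/12 ≥ u/8 (`poissonCdf_le_of_rate`).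

The guarantees use the same two test rates, not the crossing itself. For the lower bound, choose the
threshold so that k(1 - 2u) agents clear in expectation. This choice ignores the valuations, the
clearing mass is greedy and hence worth at least (1 - 2u) times the ex-ante optimum, and a clearing
agent is turned away with probability at most 1/k (`staticReward_ge`, `sum_mul_le_of_greedy`). For
the upper bound, let N agents of value 1 precede one agent of value k, so that the prophet gets 2k -
1. A policy that is selective on the low agents collects few of them, and any other often has no
slot left for the last agent; as N → ∞ this trade-off becomes the Poisson one
(`staticReward_lastTop_le`, `tendsto_coinTail`).

Since Proph ≤ ExAnte and oblivious policies are static policies, it suffices to prove the lower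
bound for OST/ExAnte and the upper bound for ST/Proph. -/

/-! ### Poisson availability and fill rate, and their unique crossing -/

/-- The Poisson probability mass function with real rate `l`. -/
noncomputable def poissonTerm (l : ℝ) (x : ℕ) : ℝ :=
  Real.exp (-l) * l ^ x / x.factorial

/-- The probability that a Poisson variable with rate `l` is less than `k`. -/
noncomputable def poissonCdf (k : ℕ) (l : ℝ) : ℝ :=
  ∑ x ∈ Finset.range k, poissonTerm l x

theorem poissonTerm_nonneg {l : ℝ} (hl : 0 ≤ l) (x : ℕ) : 0 ≤ poissonTerm l x := by
  unfold poissonTerm; positivity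

theorem poissonCdf_succ (k : ℕ) (l : ℝ) :
    poissonCdf (k + 1) l = poissonCdf k l + poissonTerm l k :=
  Finset.sum_range_succ _ _

theorem hasSum_poissonTerm (l : ℝ) : HasSum (poissonTerm l) 1 := by
  have h := (NormedSpace.expSeries_div_hasSum_exp (l : ℝ)).mul_left (Real.exp (-l))
  rw [← Real.exp_eq_exp_ℝ, ← Real.exp_add, neg_add_cancel, Real.exp_zero] at h
  change HasSum (fun x => poissonTerm l x) 1
  simpa only [poissonTerm, mul_div_assoc] using! h

theorem poissonCdf_le_one {l : ℝ} (hl : 0 ≤ l) (k : ℕ) : poissonCdf k l ≤ 1 :=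
  sum_le_hasSum _ (fun x _ => poissonTerm_nonneg hl x) (hasSum_poissonTerm l)

theorem poissonBelow_eq_poissonCdf (k : ℕ) (lam : ℝ≥0) :
    poissonBelow k lam = poissonCdf k lam := by
  have h : {x : ℕ | x < k} = (Finset.range k : Set ℕ) := by ext; simp
  rw [poissonBelow, h, ← sum_measureReal_singleton]
  simp [poissonCdf, poissonTerm, poissonMeasure_real_singleton]

/-- Layer-cake formula: the sum counts the levels j < k that x does not exceed. Its expectation
expresses the fill rate through distribution functions alone. -/
theorem min_eq_sub_sum_indicator (x k : ℕ) :
    min (x : ℝ) k =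
      k - ∑ j ∈ Finset.range k, Set.indicator {y : ℕ | y < j + 1} (fun _ => (1 : ℝ)) x := by
  induction k with
  | zero => simp
  | succ k ih =>
    rw [Finset.sum_range_succ]
    rcases le_or_gt x k with h | h
    · have h1 : (x : ℝ) ≤ k := by exact_mod_cast h
      have h2 : x < k + 1 := by omega
      rw [min_eq_left h1] at ih
      rw [min_eq_left (by push_cast; linarith), Set.indicator_of_mem (by exact h2)]
      push_cast
      linarith
    · have h1 : (k : ℝ) + 1 ≤ x := by exact_mod_cast h
      have h2 : ¬ x < k + 1 := by omega
      rw [min_eq_right (by linarith)] at ih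
      rw [min_eq_right (by push_cast; linarith), Set.indicator_of_notMem (by exact h2)]
      push_cast
      linarith

theorem poissonFill_eq (k : ℕ) (lam : ℝ≥0) :
    poissonFill k lam = (k - ∑ j ∈ Finset.range k, poissonCdf (j + 1) lam) / k := by
  have hi : ∀ j ∈ Finset.range k, Integrable
      (Set.indicator {y : ℕ | y < j + 1} (fun _ => (1 : ℝ))) (poissonMeasure lam) :=
    fun j _ => (integrable_const _).indicator .of_discrete
  rw [poissonFill]
  simp_rw [min_eq_sub_sum_indicator]
  rw [integral_sub (integrable_const _) (integrable_finsetSum _ hi), integral_finsetSum _ hi]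
  simp only [integral_const, probReal_univ, one_smul]
  congr 2
  refine Finset.sum_congr rfl fun j _ => ?_
  rw [← poissonBelow_eq_poissonCdf, poissonBelow]
  exact integral_indicator_one .of_discrete

/-- Each mass has derivative p(x-1) - p(x) in the rate, so the sum telescopes. -/
theorem hasDerivAt_poissonCdf (k : ℕ) (l : ℝ) :
    HasDerivAt (poissonCdf (k + 1)) (-poissonTerm l k) l := by
  have hE : HasDerivAt (fun l : ℝ => Real.exp (-l)) (-Real.exp (-l)) l := by
    simpa using (hasDerivAt_neg l).exp
  have hT : ∀ x : ℕ, HasDerivAt (fun l : ℝ => poissonTerm l (x + 1))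
      (poissonTerm l x - poissonTerm l (x + 1)) l := by
    intro x
    have := (hE.mul (hasDerivAt_pow (x + 1) l)).div_const ((x + 1).factorial : ℝ)
    refine this.congr_deriv ?_
    simp only [poissonTerm, Nat.factorial_succ, Nat.add_sub_cancel]
    push_cast
    field_simp
    ring
  induction k with
  | zero =>
    have h : poissonCdf (0 + 1) = fun l : ℝ => Real.exp (-l) := by
      ext; simp [poissonCdf, poissonTerm]
    rw [h]
    simpa [poissonTerm] using hE
  | succ k ih =>
    have h : poissonCdf (k + 1 + 1) = fun l => poissonCdf (k + 1) l + poissonTerm l (k + 1) := by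
      ext; exact poissonCdf_succ _ _
    rw [h]
    exact (ih.add (hT k)).congr_deriv (by ring)

theorem continuous_poissonCdf (k : ℕ) : Continuous (poissonCdf k) := by
  unfold poissonCdf poissonTerm
  fun_prop

theorem strictAntiOn_poissonCdf (k : ℕ) : StrictAntiOn (poissonCdf (k + 1)) (Set.Ici 0) := by
  refine strictAntiOn_of_deriv_neg (convex_Ici 0) (continuous_poissonCdf _).continuousOn ?_
  intro l hl
  rw [interior_Ici] at hl
  have hl' : 0 < l := hl
  rw [(hasDerivAt_poissonCdf k l).deriv, poissonTerm]
  have : 0 < Real.exp (-l) * l ^ k / k.factorial := by positivity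
  linarith

theorem poissonCdf_zero_right (k : ℕ) : poissonCdf (k + 1) 0 = 1 := by
  rw [poissonCdf, Finset.sum_range_succ']
  simp [poissonTerm]

theorem tendsto_poissonCdf_atTop (k : ℕ) : Tendsto (poissonCdf k) atTop (nhds 0) := by
  have h : ∀ x : ℕ, Tendsto (fun l : ℝ => poissonTerm l x) atTop (nhds 0) := by
    intro x
    have := (Real.tendsto_pow_mul_exp_neg_atTop_nhds_zero x).div_const (x.factorial : ℝ)
    simpa [poissonTerm, mul_comm] using this
  have := tendsto_finsetSum (Finset.range k) fun x _ => h x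
  simpa only [Finset.sum_const_zero] using! this

/-- The gap between availability and fill rate is strictly decreasing in the Poisson rate. -/
theorem poisson_gap_strictAntiOn {k : ℕ} (hk : 1 ≤ k) :
    StrictAntiOn (fun l : ℝ => poissonCdf k l -
      (k - ∑ j ∈ Finset.range k, poissonCdf (j + 1) l) / k) (Set.Ici 0) := by
  intro a ha b hb hab
  obtain ⟨i, rfl⟩ : ∃ i, k = i + 1 := ⟨k - 1, by omega⟩
  have h1 := strictAntiOn_poissonCdf i ha hb hab
  have h2 : ∑ j ∈ Finset.range (i + 1), poissonCdf (j + 1) b ≤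
      ∑ j ∈ Finset.range (i + 1), poissonCdf (j + 1) a :=
    Finset.sum_le_sum fun j _ => (strictAntiOn_poissonCdf j ha hb hab).le
  have h3 : ((i + 1 : ℕ) - ∑ j ∈ Finset.range (i + 1), poissonCdf (j + 1) a) / ((i + 1 : ℕ) : ℝ) ≤
      ((i + 1 : ℕ) - ∑ j ∈ Finset.range (i + 1), poissonCdf (j + 1) b) / ((i + 1 : ℕ) : ℝ) := by
    gcongr
  simp only
  linarith

/-- The gap is continuous, equals 1 at rate 0 and tends to -1, so it vanishes somewhere; strict
monotonicity makes the zero unique. -/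
theorem existsUnique_poissonBelow_eq_poissonFill {k : ℕ} (hk : 1 ≤ k) :
    ∃! lam : ℝ≥0, poissonBelow k lam = poissonFill k lam := by
  set g : ℝ → ℝ := fun l => poissonCdf k l -
      (k - ∑ j ∈ Finset.range k, poissonCdf (j + 1) l) / k with hg
  have hiff : ∀ lam : ℝ≥0, poissonBelow k lam = poissonFill k lam ↔ g lam = 0 := by
    intro lam
    rw [poissonBelow_eq_poissonCdf, poissonFill_eq, hg, sub_eq_zero]
  have hk0 : (k : ℝ) ≠ 0 := by positivity
  have hcont : Continuous g := by
    have := fun j => continuous_poissonCdf j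
    fun_prop
  have h0 : g 0 = 1 := by
    obtain ⟨i, rfl⟩ : ∃ i, k = i + 1 := ⟨k - 1, by omega⟩
    simp [hg, poissonCdf_zero_right]
  have hlim : Tendsto g atTop (nhds (0 - (k - ∑ j ∈ Finset.range k, (0 : ℝ)) / k)) :=
    (tendsto_poissonCdf_atTop k).sub ((tendsto_const_nhds.sub
      (tendsto_finsetSum _ fun j _ => tendsto_poissonCdf_atTop (j + 1))).div_const _)
  have hlim' : Tendsto g atTop (nhds (-1)) := by simpa [hk0] using hlim
  obtain ⟨b, hb0, hb⟩ := ((eventually_ge_atTop (0 : ℝ)).and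
    (hlim'.eventually (gt_mem_nhds (by norm_num : (-1 : ℝ) < 0)))).exists
  obtain ⟨c, hc, hgc⟩ := intermediate_value_Icc' hb0 hcont.continuousOn
    (show (0 : ℝ) ∈ Set.Icc (g b) (g 0) from ⟨hb.le, by rw [h0]; norm_num⟩)
  refine ⟨⟨c, hc.1⟩, (hiff _).2 hgc, fun y hy => ?_⟩
  have hy' := (hiff y).1 hy
  refine NNReal.coe_injective ?_
  exact (poisson_gap_strictAntiOn hk).injOn y.2 hc.1 (hy'.trans hgc.symm)

/-- The left side is E[(k - X)⁺]. The induction closes by the recursion (k+1) p(k+1) = l p(k). -/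
theorem sum_poissonCdf_eq (k : ℕ) (l : ℝ) :
    ∑ j ∈ Finset.range k, poissonCdf (j + 1) l =
      k * poissonCdf k l - l * poissonCdf k l + k * poissonTerm l k := by
  induction k with
  | zero => simp [poissonCdf]
  | succ k ih =>
    have h : ((k : ℝ) + 1) * poissonTerm l (k + 1) = l * poissonTerm l k := by
      simp only [poissonTerm, Nat.factorial_succ]
      push_cast
      field_simp
      ring
    rw [Finset.sum_range_succ, ih, poissonCdf_succ]
    push_cast
    rw [h]
    ring

/-- By the closed form the two sides differ by k · Pr[X > k]. This turns a lower bound on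
availability into one on the fill rate. -/
theorem mul_poissonCdf_le_sub_sum {l : ℝ} (hl : 0 ≤ l) (k : ℕ) :
    l * poissonCdf k l ≤ k - ∑ j ∈ Finset.range k, poissonCdf (j + 1) l := by
  have h1 := poissonCdf_le_one hl (k + 1)
  rw [poissonCdf_succ] at h1
  rw [sum_poissonCdf_eq]
  nlinarith [Nat.cast_nonneg (α := ℝ) k]

/-- This is E[min{X,k}] ≤ E[X]. Both sides vanish at rate 0, and the left one has derivative Pr[X <
k] ≤ 1. -/
theorem sub_sum_poissonCdf_le {l : ℝ} (hl : 0 ≤ l) (k : ℕ) :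
    k - ∑ j ∈ Finset.range k, poissonCdf (j + 1) l ≤ l := by
  set g : ℝ → ℝ := fun l => l - (k - ∑ j ∈ Finset.range k, poissonCdf (j + 1) l)
  have hd : ∀ l, HasDerivAt g (1 - poissonCdf k l) l := by
    intro l
    have h1 := HasDerivAt.fun_sum fun j (_ : j ∈ Finset.range k) => hasDerivAt_poissonCdf j l
    have h2 := (hasDerivAt_id l).sub (h1.const_sub (k : ℝ))
    refine h2.congr_deriv ?_
    simp [poissonCdf]
  have hm : MonotoneOn g (Set.Ici 0) := by
    refine monotoneOn_of_deriv_nonneg (convex_Ici 0)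
      (fun x _ => (hd x).continuousAt.continuousWithinAt)
      (fun x _ => (hd x).differentiableAt.differentiableWithinAt) fun x hx => ?_
    rw [interior_Ici] at hx
    rw [(hd x).deriv]
    linarith [poissonCdf_le_one (le_of_lt hx) k]
  have h := hm (Set.mem_Ici.2 le_rfl) hl hl
  simp only [g, poissonCdf_zero_right] at h
  simp at h
  linarith

/-! ### Poisson tail bounds from above and below -/

/-- Chernoff bound: the indicator of x ≥ k is at most e^(s(x-k)), and tilting Pois(l) by e^(sx)
gives a multiple of Pois(l e^s), whose masses sum to 1. -/
theorem one_sub_poissonCdf_le_exp {l s : ℝ} (hl : 0 ≤ l) (hs : 0 ≤ s) (k : ℕ) :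
    1 - poissonCdf k l ≤ Real.exp (l * (Real.exp s - 1) - s * k) := by
  have h1 := (hasSum_poissonTerm (l * Real.exp s)).mul_left
    (Real.exp (l * (Real.exp s - 1) - s * k))
  have h2 : HasSum (fun x => if x ∈ Finset.range k then poissonTerm l x else 0)
      (poissonCdf k l) := by
    have : HasSum (fun x => if x ∈ Finset.range k then poissonTerm l x else 0)
        (∑ x ∈ Finset.range k, if x ∈ Finset.range k then poissonTerm l x else 0) :=
      hasSum_sum_of_ne_finset_zero fun x hx => if_neg hx
    rwa [Finset.sum_ite_mem, Finset.inter_self] at this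
  have h3 := hasSum_le (fun x => ?_) (hasSum_poissonTerm l) (h2.add h1)
  · linarith
  · have key : Real.exp (l * (Real.exp s - 1) - s * k) * poissonTerm (l * Real.exp s) x =
        Real.exp (s * (x - k)) * poissonTerm l x := by
      simp only [poissonTerm, mul_pow, ← Real.exp_nat_mul]
      rw [← mul_div_assoc, ← mul_div_assoc]
      congr 1
      calc _ = (Real.exp (l * (Real.exp s - 1) - s * k) * Real.exp (-(l * Real.exp s)) *
            Real.exp (x * s)) * l ^ x := by ring
        _ = (Real.exp (s * (x - k)) * Real.exp (-l)) * l ^ x := by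
          rw [← Real.exp_add, ← Real.exp_add, ← Real.exp_add]
          ring_nf
        _ = _ := by ring
    rw [key]
    have hp := poissonTerm_nonneg hl x
    split_ifs with hx
    · have := mul_nonneg (Real.exp_nonneg (s * (x - k))) hp
      linarith
    · have hkx : (k : ℝ) ≤ x := by
        have : k ≤ x := by simpa using hx
        exact_mod_cast this
      have : 1 ≤ Real.exp (s * (x - k)) :=
        Real.one_le_exp (mul_nonneg hs (by linarith))
      nlinarith

theorem factorial_le_stirling {x : ℕ} (hx : 1 ≤ x) :
    (x.factorial : ℝ) ≤ Real.exp 1 * Real.sqrt x * (x / Real.exp 1) ^ x := by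
  obtain ⟨y, rfl⟩ : ∃ y, x = y + 1 := ⟨x - 1, by omega⟩
  have h := Stirling.stirlingSeq'_antitone (Nat.zero_le y)
  simp only [Function.comp, Nat.succ_eq_add_one, zero_add, Stirling.stirlingSeq_one] at h
  rw [Stirling.stirlingSeq, div_le_iff₀ (by positivity)] at h
  refine h.trans_eq ?_
  rw [Real.sqrt_mul (by norm_num)]
  field_simp

/-- Stirling bounds x! from above, and x/l ≤ e^(x/l - 1) bounds (x/l)^x; the exponents then combine
into the exact square -(x-l)²/l. -/
theorem le_poissonTerm {l : ℝ} (hl : 0 < l) {x : ℕ} (hx : 1 ≤ x) :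
    Real.exp (-(x - l) ^ 2 / l) / (Real.exp 1 * Real.sqrt x) ≤ poissonTerm l x := by
  have hx0 : (0 : ℝ) < x := by exact_mod_cast hx
  have h1 : (x / l) ^ x ≤ Real.exp (x * (x / l - 1)) := by
    rw [Real.exp_nat_mul]
    gcongr
    have := Real.add_one_le_exp (x / l - 1)
    linarith
  rw [poissonTerm, div_le_div_iff₀ (by positivity) (by positivity)]
  calc Real.exp (-(x - l) ^ 2 / l) * x.factorial
      ≤ Real.exp (-(x - l) ^ 2 / l) * (Real.exp 1 * Real.sqrt x * (x / Real.exp 1) ^ x) := by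
        gcongr; exact factorial_le_stirling hx
    _ = Real.exp (-(x - l) ^ 2 / l) * (x / l) ^ x * Real.exp (-x) *
          l ^ x * (Real.exp 1 * Real.sqrt x) := by
        have : Real.exp (-(x : ℝ)) = (Real.exp 1 ^ x)⁻¹ := by
          rw [Real.exp_neg, ← Real.exp_nat_mul, mul_one]
        rw [this, div_pow, div_pow]
        field_simp
    _ ≤ Real.exp (-(x - l) ^ 2 / l) * Real.exp (x * (x / l - 1)) * Real.exp (-x) *
          l ^ x * (Real.exp 1 * Real.sqrt x) := by gcongr
    _ = Real.exp (-l) * l ^ x * (Real.exp 1 * Real.sqrt x) := by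
        rw [← Real.exp_add, ← Real.exp_add]
        congr 3
        field_simp
        ring

/-! ### The error rate and the Poisson estimates at the two test rates -/

/-- The rate `√(log k / k)`. -/
noncomputable def errorRate (k : ℕ) : ℝ :=
  Real.sqrt (Real.log k / k)

theorem errorRate_nonneg (k : ℕ) : 0 ≤ errorRate k :=
  Real.sqrt_nonneg _

theorem mul_errorRate_sq {k : ℕ} (hk : 1 ≤ k) : k * errorRate k ^ 2 = Real.log k := by
  have h1 : (1 : ℝ) ≤ k := by exact_mod_cast hk
  rw [errorRate, Real.sq_sqrt (div_nonneg (Real.log_nonneg h1) (by linarith))]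
  field_simp

theorem tendsto_errorRate : Tendsto errorRate atTop (nhds 0) := by
  have h1 : Tendsto (fun k : ℕ => Real.log k / k) atTop (nhds 0) :=
    (Real.isLittleO_log_id_atTop.tendsto_div_nhds_zero).comp tendsto_natCast_atTop_atTop
  have h2 := h1.sqrt
  rwa [Real.sqrt_zero] at h2

theorem eventually_le_log (c : ℝ) : ∀ᶠ k : ℕ in atTop, c ≤ Real.log k :=
  (Real.tendsto_log_atTop.comp tendsto_natCast_atTop_atTop).eventually (eventually_ge_atTop c)

theorem inv_le_errorRate {k : ℕ} (hk : 1 ≤ k) (hlog : 1 ≤ Real.log k) :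
    1 / (k : ℝ) ≤ errorRate k := by
  have h1 : (1 : ℝ) ≤ k := by exact_mod_cast hk
  refine Real.le_sqrt_of_sq_le ?_
  rw [div_pow, one_pow, div_le_div_iff₀ (by positivity) (by positivity)]
  nlinarith

theorem exp_sub_one_le {u : ℝ} (h0 : 0 ≤ u) (h1 : u ≤ 1) : Real.exp u - 1 ≤ u + u ^ 2 := by
  have h := Real.abs_exp_sub_one_sub_id_le (x := u) (by rwa [abs_of_nonneg h0])
  linarith [(abs_le.1 h).2]

/-- The Chernoff bound at the rate `k (1 - 2 √(log k / k))`. -/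
theorem exp_chernoff_le {k : ℕ} (hk : 1 ≤ k) (hu : errorRate k ≤ 1 / 2) :
    Real.exp (k * (1 - 2 * errorRate k) * (Real.exp (errorRate k) - 1) - errorRate k * k) ≤
      1 / k := by
  set u := errorRate k with hu_def
  have hu0 : 0 ≤ u := errorRate_nonneg k
  have h1 : (1 : ℝ) ≤ k := by exact_mod_cast hk
  have hlog := mul_errorRate_sq hk
  rw [← hu_def] at hlog
  have hE := exp_sub_one_le hu0 (by linarith)
  have hA : 0 ≤ k * (1 - 2 * u) := mul_nonneg (by linarith) (by linarith)
  -- With e^u - 1 ≤ u + u² the exponent is at most -ku² - 2ku³, and ku² = log k.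
  have hB : k * (1 - 2 * u) * (Real.exp u - 1) - u * k ≤ -Real.log k := by
    have := mul_le_mul_of_nonneg_left hE hA
    have h3 : 0 ≤ k * u ^ 3 := by positivity
    nlinarith
  calc _ ≤ Real.exp (-Real.log k) := Real.exp_le_exp.2 hB
    _ = 1 / k := by rw [Real.exp_neg, Real.exp_log (by linarith), one_div]

/-- Anti-concentration: each of about √k points just above k has mass at least k^(-1/8)/(6√k), and
k^(-1/8)/12 exceeds u/8 = √(log k) · k^(-1/2)/8. -/
theorem poissonCdf_le_of_rate {k : ℕ} (hk : 4 ≤ k) (hlog : 64 ≤ Real.log k)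
    (hu : errorRate k ≤ 1) :
    poissonCdf k (k - k * errorRate k / 8) ≤ 1 - errorRate k / 8 := by
  set u := errorRate k with hu_def
  set L := Real.log k with hL
  have hu0 : 0 ≤ u := errorRate_nonneg k
  have hk4 : (4 : ℝ) ≤ k := by exact_mod_cast hk
  have hkpos : (0 : ℝ) < k := by linarith
  have hku : k * u ^ 2 = L := mul_errorRate_sq (by omega)
  set l : ℝ := k - k * u / 8 with hl
  have hlk : k / 2 ≤ l := by nlinarith
  have hl0 : 0 < l := by linarith
  have hsq : Real.sqrt k ^ 2 = k := Real.sq_sqrt hkpos.le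
  have hsq2 : 2 ≤ Real.sqrt k := Real.le_sqrt_of_sq_le (by linarith)
  have hsqku : Real.sqrt k ≤ k * u / 8 := by
    refine Real.sqrt_le_iff.2 ⟨by positivity, ?_⟩
    calc (k : ℝ) ≤ k * (L / 64) := by nlinarith
      _ = (k * u / 8) ^ 2 := by rw [← hku]; ring
  -- The window has length at most √k ≤ ku/8, so its points stay within ku/4 of the rate.
  set M := Nat.sqrt k with hM
  have hM1 : (M : ℝ) ≤ Real.sqrt k := Real.nat_sqrt_le_real_sqrt
  have hM2 : Real.sqrt k / 2 ≤ M := by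
    have : Real.sqrt k ≤ M + 1 := Real.real_sqrt_le_nat_sqrt_succ
    linarith
  have hterm : ∀ x ∈ Finset.Ico k (k + M),
      Real.exp (-(L / 8)) / (6 * Real.sqrt k) ≤ poissonTerm l x := by
    intro x hx
    rw [Finset.mem_Ico] at hx
    have hx1 : (k : ℝ) ≤ x := by exact_mod_cast hx.1
    have hx2 : (x : ℝ) ≤ k + M := by exact_mod_cast hx.2.le
    have hd0 : 0 ≤ x - l := by nlinarith [mul_nonneg hkpos.le hu0]
    have hd : x - l ≤ k * u / 4 := by rw [hl]; linarith
    refine le_trans ?_ (le_poissonTerm hl0 (by omega))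
    have hsx : Real.sqrt x ≤ 2 * Real.sqrt k := by
      refine Real.sqrt_le_iff.2 ⟨by positivity, ?_⟩
      rw [mul_pow, hsq]
      nlinarith
    have hexp : -(L / 8) ≤ -(x - l) ^ 2 / l := by
      rw [neg_div, neg_le_neg_iff, div_le_iff₀ hl0]
      calc (x - l) ^ 2 ≤ (k * u / 4) ^ 2 := by gcongr
        _ = L / 8 * (k / 2) := by rw [← hku]; ring
        _ ≤ L / 8 * l := by gcongr
    have he : Real.exp 1 ≤ 3 := by linarith [Real.exp_one_lt_d9]
    have hx0 : (0 : ℝ) < x := by linarith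
    calc _ ≤ Real.exp (-(x - l) ^ 2 / l) / (6 * Real.sqrt k) := by gcongr
      _ = Real.exp (-(x - l) ^ 2 / l) / (3 * (2 * Real.sqrt k)) := by ring_nf
      _ ≤ _ := by gcongr
  have hsum : poissonCdf (k + M) l = poissonCdf k l + ∑ x ∈ Finset.Ico k (k + M), poissonTerm l x :=
    (Finset.sum_range_add_sum_Ico _ (Nat.le_add_right k M)).symm
  have hlow := Finset.card_nsmul_le_sum _ _ _ hterm
  rw [Nat.card_Ico, Nat.add_sub_cancel_left, nsmul_eq_mul] at hlow
  have hone := poissonCdf_le_one hl0.le (k + M)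
  have hlow2 : Real.exp (-(L / 8)) / 12 ≤ M * (Real.exp (-(L / 8)) / (6 * Real.sqrt k)) := by
    calc Real.exp (-(L / 8)) / 12
        = Real.sqrt k / 2 * (Real.exp (-(L / 8)) / (6 * Real.sqrt k)) := by
          field_simp; norm_num
      _ ≤ _ := by gcongr
  have hu_eq : u = Real.sqrt L * Real.exp (-(L / 2)) := by
    have : Real.sqrt k = Real.exp (L / 2) := by
      rw [Real.exp_half, hL, Real.exp_log hkpos]
    rw [hu_def, errorRate, Real.sqrt_div (by linarith), this, Real.exp_neg, div_eq_mul_inv]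
  have hL8 : 8 ≤ Real.sqrt L := Real.le_sqrt_of_sq_le (by linarith)
  have hLsq : Real.sqrt L ^ 2 = L := Real.sq_sqrt (by linarith)
  -- Dividing by k^(-1/2) leaves (3/2)√L ≤ e^(3L/8), which follows from e^y ≥ y + 1 and √L ≥ 8.
  have hfin : u / 8 ≤ Real.exp (-(L / 8)) / 12 := by
    have h1 : 3 / 2 * Real.sqrt L ≤ Real.exp (3 * L / 8) := by
      have := Real.add_one_le_exp (3 * L / 8)
      nlinarith
    have h2 : Real.exp (-(L / 8)) = Real.exp (3 * L / 8) * Real.exp (-(L / 2)) := by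
      rw [← Real.exp_add]; ring_nf
    rw [h2, hu_eq]
    nlinarith [Real.exp_pos (-(L / 2))]
  linarith

theorem isTheta_errorRate_of_bounds {f : ℕ → ℝ} {c C : ℝ} (hc : 0 < c)
    (h1 : ∀ᶠ k in atTop, c * errorRate k ≤ f k) (h2 : ∀ᶠ k in atTop, f k ≤ C * errorRate k) :
    f =Θ[atTop] fun k : ℕ => Real.sqrt (Real.log k / k) := by
  constructor
  · refine IsBigO.of_bound C ?_
    filter_upwards [h1, h2] with k hk1 hk2
    have h0 : 0 ≤ errorRate k := errorRate_nonneg k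
    change ‖f k‖ ≤ C * ‖errorRate k‖
    rwa [Real.norm_of_nonneg h0, Real.norm_of_nonneg (le_trans (by positivity) hk1)]
  · refine IsBigO.of_bound c⁻¹ ?_
    filter_upwards [h1] with k hk1
    have h0 : 0 ≤ errorRate k := errorRate_nonneg k
    change ‖errorRate k‖ ≤ c⁻¹ * ‖f k‖
    rw [Real.norm_of_nonneg h0, Real.norm_of_nonneg (le_trans (by positivity) hk1)]
    rwa [← div_eq_inv_mul, le_div_iff₀ hc, mul_comm]

theorem poissonBelow_antitone {k : ℕ} (hk : 1 ≤ k) : Antitone (poissonBelow k) := by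
  intro a b hab
  obtain ⟨i, rfl⟩ : ∃ i, k = i + 1 := ⟨k - 1, by omega⟩
  rw [poissonBelow_eq_poissonCdf, poissonBelow_eq_poissonCdf]
  exact (strictAntiOn_poissonCdf i).antitoneOn a.2 b.2 hab

theorem poissonFill_monotone (k : ℕ) : Monotone (poissonFill k) := by
  intro a b hab
  rw [poissonFill_eq, poissonFill_eq]
  gcongr with j
  exact (strictAntiOn_poissonCdf j).antitoneOn a.2 b.2 hab

/-- The position of `lam k` relative to a test rate is unknown, but on either side one of the two
monotone functions transfers its bound at the test rate to the common value. -/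
theorem poissonBelow_bounds {lam : ℕ → ℝ≥0}
    (h : ∀ k : ℕ, 1 ≤ k → poissonBelow k (lam k) = poissonFill k (lam k)) :
    ∀ᶠ k in atTop, 1 / 8 * errorRate k ≤ 1 - poissonBelow k (lam k) ∧
      1 - poissonBelow k (lam k) ≤ 3 * errorRate k := by
  filter_upwards [eventually_ge_atTop 4, eventually_le_log 64,
    tendsto_errorRate.eventually (ge_mem_nhds (by norm_num : (0 : ℝ) < 1 / 2))] with k hk hlog hu
  have hk4 : (4 : ℝ) ≤ k := by exact_mod_cast hk
  have hkpos : (0 : ℝ) < k := by linarith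
  have hu0 := errorRate_nonneg k
  have hv := h k (by omega)
  constructor
  · have hl0 : 0 ≤ k - k * errorRate k / 8 := by nlinarith
    set l : ℝ≥0 := ⟨k - k * errorRate k / 8, hl0⟩
    have hB : poissonBelow k l ≤ 1 - errorRate k / 8 := by
      rw [poissonBelow_eq_poissonCdf]
      exact poissonCdf_le_of_rate hk hlog (by linarith)
    have hF : poissonFill k l ≤ 1 - errorRate k / 8 := by
      rw [poissonFill_eq, div_le_iff₀ hkpos]
      refine (sub_sum_poissonCdf_le l.coe_nonneg k).trans_eq ?_
      change (k : ℝ) - k * errorRate k / 8 = _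
      ring
    rcases le_total l (lam k) with hle | hle
    · linarith [poissonBelow_antitone (show 1 ≤ k by omega) hle]
    · linarith [poissonFill_monotone k hle]
  · have hl0 : 0 ≤ k * (1 - 2 * errorRate k) := mul_nonneg hkpos.le (by linarith)
    set l : ℝ≥0 := ⟨k * (1 - 2 * errorRate k), hl0⟩
    have hinv := inv_le_errorRate (k := k) (by omega) (by linarith)
    have hB : 1 - errorRate k ≤ poissonBelow k l := by
      rw [poissonBelow_eq_poissonCdf]
      have h1 := (one_sub_poissonCdf_le_exp hl0 hu0 k).trans (exp_chernoff_le (by omega) hu)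
      change _ ≤ poissonCdf k (k * (1 - 2 * errorRate k))
      linarith
    have hF : 1 - 3 * errorRate k ≤ poissonFill k l := by
      rw [poissonFill_eq, le_div_iff₀ hkpos]
      refine le_trans ?_ (mul_poissonCdf_le_sub_sum l.coe_nonneg k)
      have h2 := mul_le_mul_of_nonneg_left hB hl0
      rw [poissonBelow_eq_poissonCdf] at h2
      change _ ≤ k * (1 - 2 * errorRate k) * poissonCdf k l
      nlinarith [mul_nonneg hkpos.le (mul_nonneg hu0 hu0)]
    rcases le_total l (lam k) with hle | hle
    · linarith [poissonFill_monotone k hle]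
    · linarith [poissonBelow_antitone (show 1 ≤ k by omega) hle]

/-! ### Expectations over independent types and coins -/

theorem TypeDist.weight_nonneg {n m : ℕ} (G : TypeDist n m) (t : Fin n → Fin m) :
    0 ≤ G.weight t :=
  Finset.prod_nonneg fun _ _ => G.prob_nonneg _ _

theorem TypeDist.sum_weight_mul_prod {n m : ℕ} (G : TypeDist n m) (h : Fin n → Fin m → ℝ) :
    ∑ t, G.weight t * ∏ i, h i (t i) = ∏ i, ∑ j, G.prob i j * h i j := by
  rw [Finset.prod_univ_sum, Fintype.piFinset_univ]
  exact Finset.sum_congr rfl fun t _ => Finset.prod_mul_distrib.symm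

theorem TypeDist.sum_weight {n m : ℕ} (G : TypeDist n m) : ∑ t, G.weight t = 1 := by
  have h := G.sum_weight_mul_prod fun _ _ => 1
  simpa [G.sum_prob] using h

theorem TypeDist.sum_weight_mul_apply {n m : ℕ} (G : TypeDist n m) (i : Fin n) (f : Fin m → ℝ) :
    ∑ t, G.weight t * f (t i) = ∑ j, G.prob i j * f j := by
  have h := G.sum_weight_mul_prod fun i' j => if i' = i then f j else 1
  rw [Fintype.prod_eq_single i (fun i' hi' => by simp [hi', G.sum_prob])] at h
  simpa using h

theorem coinWeight_nonneg {n : ℕ} {ρ : ℝ} (h0 : 0 ≤ ρ) (h1 : ρ ≤ 1) (b : Fin n → Bool) :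
    0 ≤ coinWeight ρ b :=
  Finset.prod_nonneg fun i _ => by split_ifs <;> linarith

theorem coinWeight_le_one {n : ℕ} {ρ : ℝ} (h0 : 0 ≤ ρ) (h1 : ρ ≤ 1) (b : Fin n → Bool) :
    coinWeight ρ b ≤ 1 :=
  Finset.prod_le_one (fun i _ => by split_ifs <;> linarith) fun i _ => by split_ifs <;> linarith

theorem sum_coinWeight_mul_prod {n : ℕ} (ρ : ℝ) (h : Fin n → Bool → ℝ) :
    ∑ b, coinWeight ρ b * ∏ i, h i (b i) = ∏ i, (ρ * h i true + (1 - ρ) * h i false) := by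
  have : ∀ i, ρ * h i true + (1 - ρ) * h i false =
      ∑ c : Bool, (if c = true then ρ else 1 - ρ) * h i c := fun i => by simp
  simp_rw [this]
  rw [Finset.prod_univ_sum, Fintype.piFinset_univ]
  exact Finset.sum_congr rfl fun t _ => Finset.prod_mul_distrib.symm

theorem sum_weight_coinWeight_mul_prod {n m : ℕ} (G : TypeDist n m) (ρ : ℝ)
    (h : Fin n → Fin m → Bool → ℝ) :
    ∑ t, ∑ b, G.weight t * coinWeight ρ b * ∏ i, h i (t i) (b i) =
      ∏ i, ∑ j, G.prob i j * (ρ * h i j true + (1 - ρ) * h i j false) := by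
  rw [← G.sum_weight_mul_prod fun i j => ρ * h i j true + (1 - ρ) * h i j false]
  refine Finset.sum_congr rfl fun t _ => ?_
  rw [← sum_coinWeight_mul_prod ρ fun i c => h i (t i) c, Finset.mul_sum]
  exact Finset.sum_congr rfl fun b _ => mul_assoc _ _ _

/-! ### A lower bound for the reward of a static threshold -/

/-- The probability that an agent of type `j` clears the threshold `(J, ρ)`. -/
noncomputable def clearWeight {m : ℕ} (J : Fin m) (ρ : ℝ) (j : Fin m) : ℝ :=
  if j < J then 1 else if j = J then ρ else 0

theorem clearWeight_nonneg {m : ℕ} (J : Fin m) {ρ : ℝ} (h0 : 0 ≤ ρ) (j : Fin m) :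
    0 ≤ clearWeight J ρ j := by
  unfold clearWeight
  split_ifs <;> simp [h0]

open Classical in
/-- Indicator that an agent of type `j` with coin `c` clears the threshold `J`. -/
noncomputable def clearInd {m : ℕ} (J j : Fin m) (c : Bool) : ℝ :=
  if j < J ∨ (j = J ∧ c = true) then 1 else 0

/-- Averages out the tie-breaking coin. The function `f` is arbitrary so that this covers both the
collected value and the exponential moment. -/
theorem clearInd_average {m : ℕ} (J : Fin m) (ρ : ℝ) (j : Fin m) (f : ℝ → ℝ) :
    ρ * f (clearInd J j true) + (1 - ρ) * f (clearInd J j false) =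
      f 0 + clearWeight J ρ j * (f 1 - f 0) := by
  unfold clearInd clearWeight
  by_cases h1 : j < J
  · simp [h1]; ring
  · by_cases h2 : j = J
    · simp [h2]; ring
    · simp [h1, h2]; ring

theorem prod_exp_clearInd {n m : ℕ} (J : Fin m) (t : Fin n → Fin m) (b : Fin n → Bool) (s : ℝ)
    (A : Finset (Fin n)) :
    ∏ i ∈ A, Real.exp (s * clearInd J (t i) (b i)) =
      Real.exp (s * ∑ i ∈ A, clearInd J (t i) (b i)) := by
  rw [← Real.exp_sum, Finset.mul_sum]

/-- A clearing agent is refused only if at least k earlier agents clear, and then e^(s(count - k)) ≥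
1. Counting all other agents, not just the earlier ones, only enlarges the penalty and makes it a
product over agents, ready for independence. -/
theorem sum_acceptedSet_ge {k n m : ℕ} (J : Fin m) (t : Fin n → Fin m) (b : Fin n → Bool)
    {r : Fin m → ℝ} (hr : ∀ j, 0 ≤ r j) {s : ℝ} (hs : 0 ≤ s) :
    ∑ i, (clearInd J (t i) (b i) * r (t i) - Real.exp (-(s * k)) *
        (clearInd J (t i) (b i) * r (t i) *
          ∏ i' ∈ Finset.univ.erase i, Real.exp (s * clearInd J (t i') (b i')))) ≤
      ∑ i ∈ acceptedSet k J t b, r (t i) := by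
  classical
  rw [acceptedSet, Finset.sum_filter]
  refine Finset.sum_le_sum fun i _ => ?_
  by_cases hc : Clears J t b i
  · have h1 : clearInd J (t i) (b i) = 1 := if_pos hc
    rw [h1, one_mul, prod_exp_clearInd, ← mul_assoc, mul_comm (Real.exp _) (r _), mul_assoc,
      ← Real.exp_add]
    split_ifs with hk
    · have := mul_nonneg (hr (t i)) (Real.exp_nonneg (-(s * k) + s *
        ∑ i ∈ Finset.univ.erase i, clearInd J (t i) (b i)))
      linarith
    · have hk2 : k ≤ (Finset.univ.filter fun i' => i' < i ∧ Clears J t b i').card := by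
        by_contra hlt
        refine hk ⟨hc, ?_⟩
        convert! not_le.1 hlt
      have hk3 : (k : ℝ) ≤ ∑ i' ∈ Finset.univ.erase i, clearInd J (t i') (b i') := by
        calc (k : ℝ) ≤ (Finset.univ.filter fun i' => i' < i ∧ Clears J t b i').card := by
              exact_mod_cast hk2
          _ = ∑ i' ∈ Finset.univ.filter fun i' => i' < i ∧ Clears J t b i',
                clearInd J (t i') (b i') := by
              rw [Finset.card_eq_sum_ones, Nat.cast_sum]
              refine Finset.sum_congr rfl fun i' hi' => ?_
              rw [Nat.cast_one]
              exact (if_pos (Finset.mem_filter.1 hi').2.2).symm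
          _ ≤ _ := by
              refine Finset.sum_le_sum_of_subset_of_nonneg (fun i' hi' => ?_) fun i' _ _ => ?_
              · simp only [Finset.mem_filter, Finset.mem_univ, true_and] at hi'
                simp [hi'.1.ne]
              · unfold clearInd; split_ifs <;> norm_num
      have : 1 ≤ Real.exp (-(s * k) + s *
          ∑ i ∈ Finset.univ.erase i, clearInd J (t i) (b i)) := by
        refine Real.one_le_exp ?_
        nlinarith
      nlinarith [hr (t i)]
  · have h1 : clearInd J (t i) (b i) = 0 := if_neg hc
    simp [h1, hc]

/-- The expectation of the pointwise bound: the value of agent i is independent of the other agents'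
clearing, and each of their moment factors satisfies 1 + q(e^s - 1) ≤ e^(q(e^s - 1)), which yields
the Poisson Chernoff exponent. -/
theorem staticReward_ge {k n m : ℕ} (G : TypeDist n m) (J : Fin m) {ρ : ℝ} (h0 : 0 ≤ ρ)
    (h1 : ρ ≤ 1) {r : Fin m → ℝ} (hr : ∀ j, 0 ≤ r j) {s : ℝ} (hs : 0 ≤ s) :
    (1 - Real.exp ((∑ j, clearWeight J ρ j * ∑ i, G.prob i j) * (Real.exp s - 1) - s * k)) *
        (∑ j, r j * (clearWeight J ρ j * ∑ i, G.prob i j)) ≤ staticReward k G r J ρ := by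
  set q : Fin n → ℝ := fun i => ∑ j, G.prob i j * clearWeight J ρ j with hq
  set A : Fin n → ℝ := fun i => ∑ j, G.prob i j * (clearWeight J ρ j * r j) with hA
  have hq0 : ∀ i, 0 ≤ q i := fun i => Finset.sum_nonneg fun j _ =>
    mul_nonneg (G.prob_nonneg i j) (clearWeight_nonneg J h0 j)
  have hA0 : ∀ i, 0 ≤ A i := fun i => Finset.sum_nonneg fun j _ =>
    mul_nonneg (G.prob_nonneg i j) (mul_nonneg (clearWeight_nonneg J h0 j) (hr j))
  have hs1 : 0 ≤ Real.exp s - 1 := by linarith [Real.add_one_le_exp s]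
  have hqsum : ∑ j, clearWeight J ρ j * ∑ i, G.prob i j = ∑ i, q i := by
    simp_rw [hq, Finset.mul_sum]
    rw [Finset.sum_comm]
    exact Finset.sum_congr rfl fun i _ => Finset.sum_congr rfl fun j _ => mul_comm _ _
  have hAsum : ∑ j, r j * (clearWeight J ρ j * ∑ i, G.prob i j) = ∑ i, A i := by
    simp_rw [hA, Finset.mul_sum]
    rw [Finset.sum_comm]
    exact Finset.sum_congr rfl fun i _ => Finset.sum_congr rfl fun j _ => by ring
  rw [hqsum, hAsum]
  have hfirst : ∀ i, ∑ t, ∑ b, G.weight t * coinWeight ρ b *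
      (clearInd J (t i) (b i) * r (t i)) = A i := by
    intro i
    have h := sum_weight_coinWeight_mul_prod G ρ
      fun i' j c => if i' = i then clearInd J j c * r j else 1
    rw [Fintype.prod_eq_single i (fun i' hi' => by simp [hi', G.sum_prob])] at h
    simp only [Finset.prod_ite_eq', Finset.mem_univ, if_true] at h
    rw [h]
    refine Finset.sum_congr rfl fun j _ => ?_
    have := clearInd_average J ρ j fun x => x * r j
    rw [this]
    ring
  have hsecond : ∀ i, ∑ t, ∑ b, G.weight t * coinWeight ρ b *
      (clearInd J (t i) (b i) * r (t i) *
          ∏ i' ∈ Finset.univ.erase i, Real.exp (s * clearInd J (t i') (b i'))) ≤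
      A i * Real.exp ((∑ i, q i) * (Real.exp s - 1)) := by
    intro i
    have h := sum_weight_coinWeight_mul_prod G ρ
      fun i' j c => if i' = i then clearInd J j c * r j else Real.exp (s * clearInd J j c)
    have hl : ∀ (t : Fin n → Fin m) (b : Fin n → Bool),
        (∏ i', if i' = i then clearInd J (t i') (b i') * r (t i') else
          Real.exp (s * clearInd J (t i') (b i'))) = clearInd J (t i) (b i) * r (t i) *
          ∏ i' ∈ Finset.univ.erase i, Real.exp (s * clearInd J (t i') (b i')) := by
      intro t b
      rw [← Finset.mul_prod_erase _ _ (Finset.mem_univ i), if_pos rfl]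
      congr 1
      exact Finset.prod_congr rfl fun i' hi' => if_neg (Finset.ne_of_mem_erase hi')
    simp_rw [hl] at h
    rw [h, ← Finset.mul_prod_erase _ _ (Finset.mem_univ i)]
    refine mul_le_mul (le_of_eq ?_) ?_ (Finset.prod_nonneg fun i' _ => ?_) (hA0 i)
    · refine Finset.sum_congr rfl fun j _ => ?_
      simp only [if_true]
      have := clearInd_average J ρ j fun x => x * r j
      rw [this]
      ring
    · calc _ = ∏ i' ∈ Finset.univ.erase i, (1 + q i' * (Real.exp s - 1)) := by
            refine Finset.prod_congr rfl fun i' hi' => ?_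
            simp only [if_neg (Finset.ne_of_mem_erase hi')]
            have := fun j => clearInd_average J ρ j fun x => Real.exp (s * x)
            simp_rw [this, hq, mul_zero, Real.exp_zero, mul_one, mul_add, mul_one,
              Finset.sum_add_distrib, G.sum_prob, Finset.sum_mul, mul_assoc]
        _ ≤ ∏ i' ∈ Finset.univ.erase i, Real.exp (q i' * (Real.exp s - 1)) := by
            refine Finset.prod_le_prod (fun i' _ => ?_) fun i' _ => ?_
            · have := mul_nonneg (hq0 i') hs1
              linarith
            · linarith [Real.add_one_le_exp (q i' * (Real.exp s - 1))]
        _ = Real.exp ((∑ i' ∈ Finset.univ.erase i, q i') * (Real.exp s - 1)) := by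
            rw [← Real.exp_sum, Finset.sum_mul]
        _ ≤ _ := by
            refine Real.exp_le_exp.2 (mul_le_mul_of_nonneg_right ?_ hs1)
            exact Finset.sum_le_sum_of_subset_of_nonneg (Finset.subset_univ _) fun i' _ _ => hq0 i'
    · refine Finset.sum_nonneg fun j _ => mul_nonneg (G.prob_nonneg _ _) ?_
      have h1' : 0 ≤ 1 - ρ := by linarith
      have hpos : ∀ c, 0 ≤ (if i' = i then clearInd J j c * r j
          else Real.exp (s * clearInd J j c)) := by
        intro c
        split_ifs
        · refine mul_nonneg ?_ (hr j)
          unfold clearInd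
          split_ifs <;> norm_num
        · positivity
      exact add_nonneg (mul_nonneg h0 (hpos _)) (mul_nonneg h1' (hpos _))
  calc _ = ∑ i, (A i - Real.exp (-(s * k)) * (A i * Real.exp ((∑ i, q i) * (Real.exp s - 1)))) := by
        rw [sub_eq_add_neg ((∑ i, q i) * (Real.exp s - 1)), Real.exp_add, Finset.sum_sub_distrib,
          ← Finset.mul_sum, ← Finset.sum_mul]
        ring
    _ ≤ ∑ i, ((∑ t, ∑ b, G.weight t * coinWeight ρ b * (clearInd J (t i) (b i) * r (t i))) -
          Real.exp (-(s * k)) * ∑ t, ∑ b, G.weight t * coinWeight ρ b *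
            (clearInd J (t i) (b i) * r (t i) *
              ∏ i' ∈ Finset.univ.erase i, Real.exp (s * clearInd J (t i') (b i')))) := by
        refine Finset.sum_le_sum fun i _ => ?_
        rw [hfirst]
        exact sub_le_sub_left (mul_le_mul_of_nonneg_left (hsecond i) (Real.exp_nonneg _)) _
    _ = ∑ t, ∑ b, G.weight t * coinWeight ρ b *
          ∑ i, (clearInd J (t i) (b i) * r (t i) - Real.exp (-(s * k)) *
            (clearInd J (t i) (b i) * r (t i) *
              ∏ i' ∈ Finset.univ.erase i, Real.exp (s * clearInd J (t i') (b i')))) := by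
        simp_rw [Finset.mul_sum, ← Finset.sum_sub_distrib]
        rw [Finset.sum_comm]
        refine Finset.sum_congr rfl fun t _ => ?_
        rw [Finset.sum_comm]
        refine Finset.sum_congr rfl fun b _ => Finset.sum_congr rfl fun i _ => ?_
        ring
    _ ≤ _ := by
        refine Finset.sum_le_sum fun t _ => Finset.sum_le_sum fun b _ => ?_
        exact mul_le_mul_of_nonneg_left (sum_acceptedSet_ge J t b hr hs)
          (mul_nonneg (G.weight_nonneg t) (coinWeight_nonneg h0 h1 b))

theorem TypeDist.sum_sum_prob {n m : ℕ} (G : TypeDist n m) : ∑ j, ∑ i, G.prob i j = n := by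
  rw [Finset.sum_comm]
  simp [G.sum_prob]

/-! ### Choosing an oblivious threshold -/

/-- Take the shortest prefix of types whose mass reaches `l`; its last type is `J`, and `ρ` is the
fraction of that type's mass still needed. -/
theorem exists_threshold {m : ℕ} (P : Fin m → ℝ) {l : ℝ} (hl : 0 < l)
    (hlP : l ≤ ∑ j, P j) :
    ∃ (J : Fin m) (ρ : ℝ), 0 < ρ ∧ ρ ≤ 1 ∧ ∑ j, clearWeight J ρ j * P j = l := by
  classical
  set S : ℕ → ℝ := fun a => ∑ j : Fin m, if (j : ℕ) < a then P j else 0 with hS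
  have hex : ∃ a, l ≤ S a := ⟨m, by simpa [hS] using hlP⟩
  set a := Nat.find hex with ha
  have ha1 : l ≤ S a := Nat.find_spec hex
  have ha0 : a ≠ 0 := by
    intro h
    rw [h] at ha1
    simp [hS] at ha1
    linarith
  obtain ⟨c, hc⟩ : ∃ c, a = c + 1 := ⟨a - 1, by omega⟩
  have hc1 : S c < l := not_le.1 (Nat.find_min hex (by omega))
  have ham : c < m := by
    have hm : l ≤ S m := by simpa [hS] using hlP
    have := Nat.find_min' hex hm
    omega
  set J : Fin m := ⟨c, ham⟩ with hJ
  have hstep : S (c + 1) = S c + P J := by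
    have : P J = ∑ j, if j = J then P j else 0 := by simp
    rw [this, hS]
    simp only
    rw [← Finset.sum_add_distrib]
    refine Finset.sum_congr rfl fun j _ => ?_
    rcases lt_trichotomy (j : ℕ) c with h | h | h
    · have h2 : j ≠ J := fun e => by rw [e] at h; exact lt_irrefl _ h
      simp [h, h2, Nat.lt_succ_of_lt h]
    · have h2 : j = J := Fin.ext h
      simp [h2, hJ]
    · have h2 : j ≠ J := fun e => by rw [e] at h; exact lt_irrefl _ h
      simp [h2, not_lt.2 h.le, not_lt.2 (Nat.succ_le_of_lt h)]
  rw [hc, hstep] at ha1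
  have hP : 0 < P J := by linarith
  refine ⟨J, (l - S c) / P J, div_pos (by linarith) hP, (div_le_one hP).2 (by linarith), ?_⟩
  have : ∀ j, clearWeight J ((l - S c) / P J) j * P j =
      (if (j : ℕ) < c then P j else 0) + if j = J then l - S c else 0 := by
    intro j
    unfold clearWeight
    by_cases h1 : j < J
    · have h1' : (j : ℕ) < c := h1
      simp [h1, h1', h1.ne]
    · have h1' : ¬ (j : ℕ) < c := h1
      by_cases h2 : j = J
      · subst h2
        simp [h1', hP.ne']
      · simp [h1, h1', h2]
  simp_rw [this, Finset.sum_add_distrib]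
  simp [hS]

/-- Exchange argument: relative to the price r_J, the greedy allocation is at least as good as `c *
a` on every type separately. The price times the surplus mass is nonnegative. -/
theorem sum_mul_le_of_greedy {m : ℕ} {r : Fin m → ℝ} (hr : IsValuation r) (J : Fin m) {ρ : ℝ}
    {P a : Fin m → ℝ} {c : ℝ} (hc0 : 0 ≤ c) (hc1 : c ≤ 1)
    (ha : ∀ j, 0 ≤ a j ∧ a j ≤ P j) (hsum : c * ∑ j, a j ≤ ∑ j, clearWeight J ρ j * P j) :
    c * ∑ j, r j * a j ≤ ∑ j, r j * (clearWeight J ρ j * P j) := by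
  have h1 : ∑ j, (r j - r J) * (c * a j - clearWeight J ρ j * P j) ≤ 0 := by
    refine Finset.sum_nonpos fun j _ => ?_
    obtain ⟨h0, hP⟩ := ha j
    unfold clearWeight
    split_ifs with hj hj'
    · have : c * a j ≤ a j := mul_le_of_le_one_left h0 hc1
      exact mul_nonpos_of_nonneg_of_nonpos (sub_nonneg.2 (hr.1 hj.le)) (by linarith)
    · simp [hj']
    · have : J ≤ j := not_lt.1 hj
      have := hr.1 this
      have := mul_nonneg hc0 h0
      exact mul_nonpos_of_nonpos_of_nonneg (by linarith) (by linarith)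
  have h2 : ∑ j, (r j - r J) * (c * a j - clearWeight J ρ j * P j) =
      c * ∑ j, r j * a j - ∑ j, r j * (clearWeight J ρ j * P j) -
        r J * (c * ∑ j, a j - ∑ j, clearWeight J ρ j * P j) := by
    simp_rw [Finset.mul_sum, ← Finset.sum_sub_distrib]
    rw [Finset.mul_sum, ← Finset.sum_sub_distrib]
    exact Finset.sum_congr rfl fun j _ => by ring
  have h3 : r J * (c * ∑ j, a j - ∑ j, clearWeight J ρ j * P j) ≤ 0 :=
    mul_nonpos_of_nonneg_of_nonpos (hr.2 J) (by linarith)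
  linarith

theorem exAnteValue_le {k n m : ℕ} (G : TypeDist n m) (r : Fin m → ℝ) {B : ℝ}
    (h : ∀ a : Fin m → ℝ, ∑ j, a j ≤ k → (∀ j, 0 ≤ a j ∧ a j ≤ ∑ i, G.prob i j) →
      ∑ j, r j * a j ≤ B) : exAnteValue k G r ≤ B := by
  refine csSup_le ⟨0, 0, by simp, fun j => ⟨le_rfl, ?_⟩, by simp⟩ ?_
  · exact Finset.sum_nonneg fun i _ => G.prob_nonneg i j
  · rintro v ⟨a, h1, h2, rfl⟩
    exact h a h1 h2

theorem le_exAnteValue {k n m : ℕ} (G : TypeDist n m) {r : Fin m → ℝ} (hr : ∀ j, 0 ≤ r j)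
    {a : Fin m → ℝ} (h1 : ∑ j, a j ≤ k) (h2 : ∀ j, 0 ≤ a j ∧ a j ≤ ∑ i, G.prob i j) :
    ∑ j, r j * a j ≤ exAnteValue k G r := by
  refine le_csSup ⟨∑ j, r j * ∑ i, G.prob i j, ?_⟩ ⟨a, h1, h2, rfl⟩
  rintro v ⟨a, _, h, rfl⟩
  exact Finset.sum_le_sum fun j _ => mul_le_mul_of_nonneg_left (h j).2 (hr j)

/-- The target clearing mass k(1 - 2u) is attainable because the total mass is n > k. Scaling a
feasible ex-ante solution by 1 - 2u fits it into this mass, whatever the valuations. -/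
theorem exists_oblivious_threshold {k : ℕ} (hk : 1 ≤ k) (hu : errorRate k < 1 / 2)
    {n m : ℕ} (G : TypeDist n m) (hkn : k < n) :
    ∃ (J : Fin m) (ρ : ℝ), 0 < ρ ∧ ρ ≤ 1 ∧ ∀ r : Fin m → ℝ, IsValuation r →
      (1 - 1 / k) * (1 - 2 * errorRate k) * exAnteValue k G r ≤ staticReward k G r J ρ := by
  have hu0 := errorRate_nonneg k
  have hk1 : (1 : ℝ) ≤ k := by exact_mod_cast hk
  have hkn' : (k : ℝ) < n := by exact_mod_cast hkn
  have hl : 0 < k * (1 - 2 * errorRate k) := mul_pos (by linarith) (by linarith)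
  obtain ⟨J, ρ, h0, h1, hsum⟩ := exists_threshold (fun j => ∑ i, G.prob i j) hl
    (by rw [G.sum_sum_prob]; nlinarith)
  refine ⟨J, ρ, h0, h1, fun r hr => ?_⟩
  have hrew := staticReward_ge (k := k) G J h0.le h1 hr.2 hu0
  rw [hsum] at hrew
  refine le_trans ?_ hrew
  set V := ∑ j, r j * (clearWeight J ρ j * ∑ i, G.prob i j)
  have hV : (1 - 2 * errorRate k) * exAnteValue k G r ≤ V := by
    have hpos : 0 < 1 - 2 * errorRate k := by linarith
    rw [← le_div_iff₀' hpos]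
    refine exAnteValue_le G r fun a ha1 ha2 => ?_
    rw [le_div_iff₀' hpos]
    refine sum_mul_le_of_greedy hr J hpos.le (by linarith) ha2 ?_
    rw [hsum, mul_comm (k : ℝ)]
    exact mul_le_mul_of_nonneg_left ha1 hpos.le
  have hV0 : 0 ≤ V := Finset.sum_nonneg fun j _ => mul_nonneg (hr.2 j)
    (mul_nonneg (clearWeight_nonneg J h0.le j) (Finset.sum_nonneg fun i _ => G.prob_nonneg i j))
  have hch := exp_chernoff_le hk hu.le
  have hinv : 0 ≤ 1 - 1 / (k : ℝ) := by
    rw [sub_nonneg, div_le_one (by linarith)]; exact hk1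
  calc _ ≤ (1 - 1 / (k : ℝ)) * V := by
        rw [mul_assoc]; exact mul_le_mul_of_nonneg_left hV hinv
    _ ≤ _ := mul_le_mul_of_nonneg_right (by linarith) hV0

/-! ### Comparing the benchmarks and the policy classes -/

theorem prophValue_nonneg (k : ℕ) {n m : ℕ} (G : TypeDist n m) (r : Fin m → ℝ) :
    0 ≤ prophValue k G r := by
  refine Finset.sum_nonneg fun t _ => mul_nonneg (G.weight_nonneg t) ?_
  exact (Finset.le_sup'_of_le (fun S => ∑ i ∈ S, r (t i)) (b := ∅) (by simp) (by simp))

theorem prophValue_le_exAnteValue (k : ℕ) {n m : ℕ} (G : TypeDist n m) {r : Fin m → ℝ}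
    (hr : ∀ j, 0 ≤ r j) : prophValue k G r ≤ exAnteValue k G r := by
  have hS : ∀ t : Fin n → Fin m, ∃ S : Finset (Fin n), S.card ≤ k ∧
      (Finset.univ.filter fun S : Finset (Fin n) => S.card ≤ k).sup' ⟨∅, by simp⟩
      (fun S => ∑ i ∈ S, r (t i)) = ∑ i ∈ S, r (t i) := by
    intro t
    obtain ⟨S, hS, h⟩ := Finset.exists_mem_eq_sup'
      (s := Finset.univ.filter fun S : Finset (Fin n) => S.card ≤ k) ⟨∅, by simp⟩
      (fun S => ∑ i ∈ S, r (t i))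
    exact ⟨S, (Finset.mem_filter.1 hS).2, h⟩
  choose S hcard hsup using hS
  have hind : ∀ (t : Fin n → Fin m) (j : Fin m), (0 : ℝ) ≤ ∑ i ∈ S t, if t i = j then 1 else 0 :=
    fun t j => Finset.sum_nonneg fun i _ => by split_ifs <;> norm_num
  -- The ex-ante solution is the expected number of agents of each type in the prophet's optimal
  -- set.
  have h := le_exAnteValue (k := k) G hr
    (a := fun j => ∑ t, G.weight t * ∑ i ∈ S t, if t i = j then 1 else 0) ?_ fun j => ⟨?_, ?_⟩
  · refine le_of_eq_of_le ?_ h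
    unfold prophValue
    simp_rw [hsup, Finset.mul_sum]
    rw [Finset.sum_comm]
    refine Finset.sum_congr rfl fun t _ => ?_
    rw [Finset.sum_comm]
    refine Finset.sum_congr rfl fun i _ => ?_
    simp [mul_comm]
  · rw [Finset.sum_comm]
    calc _ = ∑ t, G.weight t * (S t).card := by
          refine Finset.sum_congr rfl fun t _ => ?_
          rw [← Finset.mul_sum, Finset.sum_comm]
          simp
      _ ≤ ∑ t, G.weight t * k := Finset.sum_le_sum fun t _ =>
          mul_le_mul_of_nonneg_left (by exact_mod_cast hcard t) (G.weight_nonneg t)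
      _ = k := by rw [← Finset.sum_mul, G.sum_weight, one_mul]
  · exact Finset.sum_nonneg fun t _ => mul_nonneg (G.weight_nonneg t) (hind t j)
  · calc _ ≤ ∑ t, G.weight t * ∑ i, if t i = j then (1 : ℝ) else 0 := by
          refine Finset.sum_le_sum fun t _ => mul_le_mul_of_nonneg_left ?_ (G.weight_nonneg t)
          refine Finset.sum_le_sum_of_subset_of_nonneg (Finset.subset_univ _) fun i _ _ => ?_
          split_ifs <;> norm_num
      _ = ∑ i, G.prob i j := by
          simp_rw [Finset.mul_sum]
          rw [Finset.sum_comm]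
          refine Finset.sum_congr rfl fun i _ => ?_
          rw [G.sum_weight_mul_apply i fun j' => if j' = j then (1 : ℝ) else 0]
          simp

theorem staticReward_le_stValue (k : ℕ) {n m : ℕ} (G : TypeDist n m) {r : Fin m → ℝ}
    (hr : ∀ j, 0 ≤ r j) (J : Fin m) {ρ : ℝ} (h0 : 0 < ρ) (h1 : ρ ≤ 1) :
    staticReward k G r J ρ ≤ stValue k G r := by
  -- A real supremum needs a bounded family; bounding each coin weight by 1 and accepting everyone
  -- gives a bound free of `J` and `ρ`.
  refine le_ciSup (f := fun x : Fin m × Set.Ioc (0 : ℝ) 1 => staticReward k G r x.1 x.2)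
    ⟨∑ t : Fin n → Fin m, ∑ _b : Fin n → Bool, G.weight t * 1 * ∑ i, r (t i), ?_⟩ (J, ⟨ρ, h0, h1⟩)
  rintro _ ⟨⟨J, ρ, h0, h1⟩, rfl⟩
  refine Finset.sum_le_sum fun t _ => Finset.sum_le_sum fun b _ => ?_
  refine mul_le_mul (mul_le_mul_of_nonneg_left (coinWeight_le_one h0.le h1 b) (G.weight_nonneg t))
    (Finset.sum_le_sum_of_subset_of_nonneg (Finset.subset_univ _) fun i _ _ => hr _)
    (Finset.sum_nonneg fun i _ => hr _) (mul_nonneg (G.weight_nonneg t) zero_le_one)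

/-! ### Binomial tails and their Poisson limit -/

theorem sum_coinWeight_mul_apply {n : ℕ} (ρ : ℝ) (i : Fin n) (f : Bool → ℝ) :
    ∑ b, coinWeight ρ b * f (b i) = ρ * f true + (1 - ρ) * f false := by
  have h := sum_coinWeight_mul_prod ρ fun i' c => if i' = i then f c else 1
  rw [Fintype.prod_eq_single i (fun i' hi' => by simp [hi'])] at h
  simpa using h

theorem sum_coinWeight {n : ℕ} (ρ : ℝ) : ∑ b : Fin n → Bool, coinWeight ρ b = 1 := by
  have h := sum_coinWeight_mul_prod (n := n) ρ fun _ _ => 1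
  simpa using h

theorem sum_coinWeight_mul_snoc {N : ℕ} (ρ : ℝ) (F : (Fin (N + 1) → Bool) → ℝ) :
    ∑ b, coinWeight ρ b * F b = ∑ b : Fin N → Bool, coinWeight ρ b *
      (ρ * F (Fin.snoc b true) + (1 - ρ) * F (Fin.snoc b false)) := by
  rw [← (Fin.snocEquiv fun _ : Fin (N + 1) => Bool).sum_comp, Fintype.sum_prod_type_right]
  refine Finset.sum_congr rfl fun b _ => ?_
  simp [Fin.snocEquiv, coinWeight, Fin.prod_univ_castSucc]
  ring

/-- The number of coins that show `true`. -/
def coinCount {n : ℕ} (b : Fin n → Bool) : ℕ :=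
  ∑ i, if b i = true then 1 else 0

/-- The probability that fewer than `k` of `N` independent coins with bias `ρ` show `true`. -/
noncomputable def coinTail (N k : ℕ) (ρ : ℝ) : ℝ :=
  ∑ b : Fin N → Bool, coinWeight ρ b * if coinCount b < k then 1 else 0

theorem coinTail_succ_succ (N k : ℕ) (ρ : ℝ) :
    coinTail (N + 1) (k + 1) ρ = ρ * coinTail N k ρ + (1 - ρ) * coinTail N (k + 1) ρ := by
  rw [coinTail, sum_coinWeight_mul_snoc, coinTail, coinTail, Finset.mul_sum, Finset.mul_sum,
    ← Finset.sum_add_distrib]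
  refine Finset.sum_congr rfl fun b _ => ?_
  have h1 : coinCount (Fin.snoc b true : Fin (N + 1) → Bool) = coinCount b + 1 := by
    unfold coinCount
    rw [Fin.sum_univ_castSucc]
    simp only [Fin.snoc_castSucc, Fin.snoc_last]
    simp
  have h2 : coinCount (Fin.snoc b false : Fin (N + 1) → Bool) = coinCount b := by
    unfold coinCount
    rw [Fin.sum_univ_castSucc]
    simp only [Fin.snoc_castSucc, Fin.snoc_last]
    simp
  rw [h1, h2]
  simp only [Nat.add_lt_add_iff_right]
  ring

theorem coinTail_mono (N : ℕ) {k k' : ℕ} (h : k ≤ k') {ρ : ℝ} (h0 : 0 ≤ ρ) (h1 : ρ ≤ 1) :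
    coinTail N k ρ ≤ coinTail N k' ρ := by
  refine Finset.sum_le_sum fun b _ => mul_le_mul_of_nonneg_left ?_ (coinWeight_nonneg h0 h1 b)
  split_ifs <;> first | omega | norm_num

/-- Induction on the number of coins, conditioning on the last one: a larger bias moves weight to
the tail with the smaller cutoff, which is the smaller tail. -/
theorem coinTail_anti (N k : ℕ) {ρ ρ' : ℝ} (h0 : 0 ≤ ρ) (h : ρ ≤ ρ') (h1 : ρ' ≤ 1) :
    coinTail N k ρ' ≤ coinTail N k ρ := by
  induction N generalizing k with
  | zero => simp [coinTail, coinWeight]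
  | succ N ih =>
    cases k with
    | zero => simp [coinTail]
    | succ k =>
      rw [coinTail_succ_succ, coinTail_succ_succ]
      have hm := coinTail_mono N (Nat.le_succ k) h0 (h.trans h1)
      have e1 := mul_le_mul_of_nonneg_left (ih k) (h0.trans h)
      have e2 := mul_le_mul_of_nonneg_left (ih (k + 1)) (sub_nonneg.2 h1)
      have e3 := mul_nonneg (sub_nonneg.2 h) (sub_nonneg.2 hm)
      simp only [Nat.succ_eq_add_one] at e3
      linarith

theorem coinTail_eq_sum_choose {N k : ℕ} (hk : k ≤ N) (ρ : ℝ) :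
    coinTail N k ρ = ∑ j ∈ Finset.range k, N.choose j * ρ ^ j * (1 - ρ) ^ (N - j) := by
  have hw : ∀ b : Fin N → Bool, coinWeight ρ b = ρ ^ coinCount b * (1 - ρ) ^ (N - coinCount b) := by
    intro b
    have h1 : coinCount b = (Finset.univ.filter fun i => b i = true).card := by
      simp [coinCount]
    have h2 : (Finset.univ.filter fun i => ¬ b i = true).card = N - coinCount b := by
      have := Finset.card_filter_add_card_filter_not (s := (Finset.univ : Finset (Fin N)))
        (fun i => b i = true)
      rw [Finset.card_univ, Fintype.card_fin] at this
      omega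
    rw [coinWeight, Finset.prod_ite, Finset.prod_const, Finset.prod_const, h2, ← h1]
  have hsum : coinTail N k ρ = ∑ S ∈ (Finset.univ : Finset (Fin N)).powerset,
      ρ ^ S.card * (1 - ρ) ^ (N - S.card) * if S.card < k then 1 else 0 := by
    unfold coinTail
    refine Finset.sum_nbij' (fun b => Finset.univ.filter fun i => b i = true)
      (fun S i => decide (i ∈ S)) (by simp) (by simp) (by simp) (by simp) fun b _ => ?_
    rw [hw]
    simp [coinCount]
  rw [hsum, Finset.sum_powerset_apply_card
    (fun c => ρ ^ c * (1 - ρ) ^ (N - c) * if c < k then (1 : ℝ) else 0), Finset.card_univ,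
    Fintype.card_fin]
  symm
  refine Finset.sum_subset_zero_on_sdiff (fun j hj => ?_) (fun j hj => ?_) fun j hj => ?_
  · rw [Finset.mem_range] at *; omega
  · have : ¬ j < k := fun h => (Finset.mem_sdiff.1 hj).2 (Finset.mem_range.2 h)
    simp [this]
  · rw [if_pos (Finset.mem_range.1 hj), nsmul_eq_mul]
    ring

theorem tendsto_coinTail (k : ℕ) (l : ℝ) :
    Tendsto (fun N : ℕ => coinTail N k (l / N)) atTop (nhds (poissonCdf k l)) := by
  have hl : Tendsto (fun N : ℕ => (N : ℝ) * (l / N)) atTop (nhds l) := by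
    refine tendsto_const_nhds.congr' ?_
    filter_upwards [eventually_ge_atTop 1] with N hN
    field_simp
  have h := tendsto_finsetSum (Finset.range k) fun j _ =>
    tendsto_choose_mul_pow_of_tendsto_mul_atTop j hl
  refine h.congr' ?_
  filter_upwards [eventually_ge_atTop k] with N hN
  exact (coinTail_eq_sum_choose hN _).symm

/-! ### The hard instance -/

theorem clears_of_mem_acceptedSet {k n m : ℕ} {J : Fin m} {t : Fin n → Fin m} {b : Fin n → Bool}
    {i : Fin n} (hi : i ∈ acceptedSet k J t b) : Clears J t b i := by
  classical
  exact (Finset.mem_filter.1 hi).2.1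

/-- The number of earlier clearing agents is below k for accepted agents and strictly increases
along them, so it injects them into `range k`. -/
theorem card_acceptedSet_le {k n m : ℕ} (J : Fin m) (t : Fin n → Fin m) (b : Fin n → Bool) :
    (acceptedSet k J t b).card ≤ k := by
  classical
  have h := Finset.card_le_card_of_injOn (s := acceptedSet k J t b) (t := Finset.range k)
    (fun i => (Finset.univ.filter fun i' => i' < i ∧ Clears J t b i').card) ?_ ?_
  · simpa using h
  · intro i hi
    have := (Finset.mem_filter.1 hi).2.2
    simp only [Finset.coe_range, Set.mem_Iio]
    convert! this
  · have key : ∀ i i' : Fin n, Clears J t b i → i < i' →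
        (Finset.univ.filter fun x => x < i ∧ Clears J t b x).card <
          (Finset.univ.filter fun x => x < i' ∧ Clears J t b x).card := by
      intro i i' hi hlt
      refine Finset.card_lt_card ⟨fun x hx => ?_, fun hsub => ?_⟩
      · simp only [Finset.mem_filter, Finset.mem_univ, true_and] at hx ⊢
        exact ⟨hx.1.trans hlt, hx.2⟩
      · have := hsub (Finset.mem_filter.2 ⟨Finset.mem_univ i, hlt, hi⟩)
        simp at this
    intro i hi i' hi' heq
    have hc := (Finset.mem_filter.1 hi).2.1
    have hc' := (Finset.mem_filter.1 hi').2.1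
    rcases lt_trichotomy i i' with h | h | h
    · exact absurd heq (key i i' hc h).ne
    · exact h
    · exact absurd heq (key i' i hc' h).ne'

/-- The types in the hard instance: all agents but the last have the lower type. -/
def lastTopType (N : ℕ) (i : Fin (N + 1)) : Fin 2 :=
  if i = Fin.last N then 0 else 1

/-- The deterministic type distributions of the hard instance. -/
def lastTopDist (N : ℕ) : TypeDist (N + 1) 2 where
  prob i j := if j = lastTopType N i then 1 else 0
  prob_nonneg i j := by split_ifs <;> norm_num
  sum_prob i := by simp

/-- The valuations of the hard instance: `k` for the top type, `1` for the lower type. -/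
def lastTopValue (k : ℕ) (j : Fin 2) : ℝ :=
  if j = 0 then k else 1

theorem isValuation_lastTopValue {k : ℕ} (hk : 1 ≤ k) : IsValuation (lastTopValue k) := by
  have h1 : (1 : ℝ) ≤ k := by exact_mod_cast hk
  constructor
  · intro a b hab
    unfold lastTopValue
    split_ifs with hb ha
    · exact le_rfl
    · exact absurd (le_antisymm (hb ▸ hab) (Fin.zero_le a)) ha
    · exact h1
    · exact le_rfl
  · intro j
    unfold lastTopValue
    split_ifs <;> linarith

theorem weight_lastTopDist (N : ℕ) (t : Fin (N + 1) → Fin 2) :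
    (lastTopDist N).weight t = if t = lastTopType N then 1 else 0 := by
  split_ifs with h
  · simp [TypeDist.weight, lastTopDist, h]
  · obtain ⟨i, hi⟩ := Function.ne_iff.1 h
    exact Finset.prod_eq_zero (Finset.mem_univ i) (by simp [lastTopDist, hi])

theorem lastTopType_castSucc {N : ℕ} (i : Fin N) : lastTopType N i.castSucc = 1 :=
  if_neg (Fin.castSucc_lt_last i).ne

theorem lastTopType_last (N : ℕ) : lastTopType N (Fin.last N) = 0 :=
  if_pos rfl

theorem prophValue_lastTop_ge {k N : ℕ} (hk : 1 ≤ k) (hN : k ≤ N) :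
    2 * (k : ℝ) - 1 ≤ prophValue k (lastTopDist N) (lastTopValue k) := by
  obtain ⟨c, rfl⟩ : ∃ c, k = c + 1 := ⟨k - 1, by omega⟩
  unfold prophValue
  simp_rw [weight_lastTopDist]
  simp only [ite_mul, one_mul, zero_mul, Finset.sum_ite_eq', Finset.mem_univ, if_true]
  -- The prophet's set consists of the last agent and the first k - 1 low agents.
  set e : Fin c ↪ Fin (N + 1) :=
    (Fin.castLEEmb (show c ≤ N by omega)).trans Fin.castSuccEmb with he
  have hlast : Fin.last N ∉ (Finset.univ : Finset (Fin c)).map e := by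
    simp only [Finset.mem_map, Finset.mem_univ, true_and, not_exists]
    intro x hx
    exact (Fin.castSucc_lt_last _).ne hx
  refine Finset.le_sup'_of_le _ (b := insert (Fin.last N) (Finset.univ.map e)) ?_ ?_
  · simp [Finset.card_insert_of_notMem hlast]
  · rw [Finset.sum_insert hlast, Finset.sum_map]
    have : ∀ x, lastTopType N (e x) = 1 := fun x => lastTopType_castSucc _
    simp [this, lastTopType_last, lastTopValue]
    linarith

theorem staticReward_lastTop (k N : ℕ) (r : Fin 2 → ℝ) (J : Fin 2) (ρ : ℝ) :
    staticReward k (lastTopDist N) r J ρ = ∑ b, coinWeight ρ b *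
      ∑ i ∈ acceptedSet k J (lastTopType N) b, r (lastTopType N i) := by
  unfold staticReward
  simp_rw [weight_lastTopDist]
  rw [Fintype.sum_eq_single (lastTopType N) (fun t ht => by simp [ht])]
  simp

theorem sum_acceptedSet_lastTop (k N : ℕ) (J : Fin 2) (b : Fin (N + 1) → Bool) :
    ∑ i ∈ acceptedSet k J (lastTopType N) b, lastTopValue k (lastTopType N i) =
      (∑ i : Fin N, if i.castSucc ∈ acceptedSet k J (lastTopType N) b then (1 : ℝ) else 0) +
        if Fin.last N ∈ acceptedSet k J (lastTopType N) b then (k : ℝ) else 0 := by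
  rw [← Finset.univ_inter (acceptedSet k J (lastTopType N) b), ← Finset.sum_ite_mem,
    Fin.sum_univ_castSucc]
  simp [lastTopType_castSucc, lastTopType_last, lastTopValue]

theorem clears_castSucc_iff {N : ℕ} (J : Fin 2) (b : Fin (N + 1) → Bool) (i : Fin N) :
    Clears J (lastTopType N) b i.castSucc ↔ J = 1 ∧ b i.castSucc = true := by
  unfold Clears
  rw [lastTopType_castSucc]
  fin_cases J <;> simp

theorem sum_acceptedSet_lastTop_le_count (k N : ℕ) (J : Fin 2) (b : Fin (N + 1) → Bool) :
    ∑ i ∈ acceptedSet k J (lastTopType N) b, lastTopValue k (lastTopType N i) ≤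
      (∑ i : Fin N, if b i.castSucc = true then (1 : ℝ) else 0) + k := by
  rw [sum_acceptedSet_lastTop]
  refine add_le_add (Finset.sum_le_sum fun i _ => ?_) ?_
  · split_ifs with h1 h2 h2
    · exact le_rfl
    · exact absurd ((clears_castSucc_iff J b i).1 (clears_of_mem_acceptedSet h1)).2 h2
    · exact zero_le_one
    · exact le_rfl
  · split_ifs
    · exact le_rfl
    · positivity

/-- The low agents fill at most k slots, and the last agent finds one only if fewer than k low coins
succeeded. -/
theorem sum_acceptedSet_lastTop_le_tail (k N : ℕ) (b : Fin (N + 1) → Bool) :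
    ∑ i ∈ acceptedSet k 1 (lastTopType N) b, lastTopValue k (lastTopType N i) ≤
      k + k * if coinCount (fun i : Fin N => b i.castSucc) < k then 1 else 0 := by
  classical
  rw [sum_acceptedSet_lastTop]
  refine add_le_add ?_ ?_
  · rw [Finset.sum_boole]
    refine Nat.cast_le.2 (le_trans ?_ (card_acceptedSet_le (k := k) 1 (lastTopType N) b))
    refine Finset.card_le_card_of_injOn Fin.castSucc (fun i hi => ?_)
      (Fin.castSucc_injective N).injOn
    exact (Finset.mem_filter.1 hi).2
  · split_ifs with h1 h2 h2
    · simp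
    · exfalso
      refine h2 (lt_of_le_of_lt ?_ (Finset.mem_filter.1 h1).2.2)
      unfold coinCount
      rw [← Finset.card_filter]
      refine Finset.card_le_card_of_injOn Fin.castSucc (fun i hi => ?_)
        (Fin.castSucc_injective N).injOn
      have hb := (Finset.mem_filter.1 hi).2
      exact Finset.mem_coe.2 (Finset.mem_filter.2 ⟨Finset.mem_univ _, Fin.castSucc_lt_last i,
        (clears_castSucc_iff 1 b i).2 ⟨rfl, hb⟩⟩)
    · simp
    · simp

/-- For `J = 0` no low agent clears. For `J = 1` and ρ ≤ l/N, the low agents contribute at most Nρ ≤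
l in expectation; for larger ρ, the last agent's chance of a slot is at most its value at l/N. -/
theorem staticReward_lastTop_le {k N : ℕ} (hN : 1 ≤ N) (J : Fin 2) {ρ l : ℝ} (hl : 0 ≤ l)
    (h0 : 0 ≤ ρ) (h1 : ρ ≤ 1) :
    staticReward k (lastTopDist N) (lastTopValue k) J ρ ≤
      max (k + l) (k + k * coinTail N k (l / N)) := by
  have hN0 : (0 : ℝ) < N := by exact_mod_cast hN
  rw [staticReward_lastTop]
  by_cases hJ : J = 0
  · refine le_trans ?_ (le_max_left _ _)
    calc _ ≤ ∑ b : Fin (N + 1) → Bool, coinWeight ρ b * k := by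
          refine Finset.sum_le_sum fun b _ =>
            mul_le_mul_of_nonneg_left ?_ (coinWeight_nonneg h0 h1 b)
          rw [sum_acceptedSet_lastTop, Finset.sum_eq_zero, zero_add]
          · split_ifs
            · exact le_rfl
            · positivity
          · intro i _
            refine if_neg fun hi => ?_
            have := ((clears_castSucc_iff J b i).1 (clears_of_mem_acceptedSet hi)).1
            rw [hJ] at this
            exact zero_ne_one this
      _ ≤ k + l := by
          rw [← Finset.sum_mul, sum_coinWeight]
          linarith
  have hJ1 : J = 1 := by omega
  subst hJ1
  rcases le_total ρ (l / N) with h | h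
  · refine le_trans ?_ (le_max_left _ _)
    calc _ ≤ ∑ b : Fin (N + 1) → Bool, coinWeight ρ b *
          ((∑ i : Fin N, if b i.castSucc = true then (1 : ℝ) else 0) + k) :=
          Finset.sum_le_sum fun b _ => mul_le_mul_of_nonneg_left
            (sum_acceptedSet_lastTop_le_count k N 1 b) (coinWeight_nonneg h0 h1 b)
      _ = N * ρ + k := by
          simp_rw [mul_add, Finset.sum_add_distrib, ← Finset.sum_mul, sum_coinWeight,
            Finset.mul_sum]
          rw [Finset.sum_comm]
          have : ∀ i : Fin N, ∑ b : Fin (N + 1) → Bool,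
              coinWeight ρ b * (if b i.castSucc = true then (1 : ℝ) else 0) = ρ := by
            intro i
            rw [sum_coinWeight_mul_apply ρ i.castSucc fun c => if c = true then (1 : ℝ) else 0]
            simp
          simp_rw [this]
          simp
      _ ≤ k + l := by
          rw [le_div_iff₀ hN0] at h
          linarith
  · refine le_trans ?_ (le_max_right _ _)
    calc _ ≤ ∑ b : Fin (N + 1) → Bool, coinWeight ρ b *
          (k + k * if coinCount (fun i : Fin N => b i.castSucc) < k then 1 else 0) :=
          Finset.sum_le_sum fun b _ => mul_le_mul_of_nonneg_left
            (sum_acceptedSet_lastTop_le_tail k N b) (coinWeight_nonneg h0 h1 b)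
      _ = k + k * coinTail N k ρ := by
          rw [sum_coinWeight_mul_snoc]
          simp only [Fin.snoc_castSucc]
          calc _ = ∑ b : Fin N → Bool, (coinWeight ρ b * k +
                k * (coinWeight ρ b * if coinCount b < k then 1 else 0)) :=
                Finset.sum_congr rfl fun b _ => by ring
            _ = _ := by
                rw [Finset.sum_add_distrib, ← Finset.sum_mul, sum_coinWeight, one_mul,
                  ← Finset.mul_sum, coinTail]
      _ ≤ _ := by
          have := coinTail_anti N k (div_nonneg hl hN0.le) h h1
          gcongr

theorem le_of_forall_prophValue_le_stValue {k : ℕ} (hk : 4 ≤ k) (hlog : 64 ≤ Real.log k)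
    (hu : errorRate k ≤ 1) {α : ℝ}
    (h : ∀ (n m : ℕ) (G : TypeDist n m) (r : Fin m → ℝ),
      k < n → IsValuation r → α * prophValue k G r ≤ stValue k G r) :
    α ≤ 1 - errorRate k / 32 := by
  have hu0 := errorRate_nonneg k
  rcases lt_or_ge α 0 with hα | hα
  · linarith
  have hk4 : (4 : ℝ) ≤ k := by exact_mod_cast hk
  set l : ℝ := k - k * errorRate k / 8 with hl_def
  have hl : 0 ≤ l := by nlinarith
  -- Here k stays fixed while N → ∞, which replaces the binomial tail by the Poisson one at rate l.
  have hN : ∀ᶠ N : ℕ in atTop,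
      α * (2 * k - 1) ≤ max (k + l) (k + k * coinTail N k (l / N)) := by
    filter_upwards [eventually_ge_atTop k] with N hN
    calc _ ≤ α * prophValue k (lastTopDist N) (lastTopValue k) :=
          mul_le_mul_of_nonneg_left (prophValue_lastTop_ge (by omega) hN) hα
      _ ≤ stValue k (lastTopDist N) (lastTopValue k) :=
          h _ _ _ _ (by omega) (isValuation_lastTopValue (by omega))
      _ ≤ _ := by
          have : Nonempty (Fin 2 × Set.Ioc (0 : ℝ) 1) := ⟨(0, ⟨1, by norm_num⟩)⟩
          exact ciSup_le fun x => staticReward_lastTop_le (by omega) x.1 hl x.2.2.1.le x.2.2.2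
  have hlim : α * (2 * k - 1) ≤ max (k + l) (k + k * poissonCdf k l) :=
    ge_of_tendsto (tendsto_const_nhds.max
      (tendsto_const_nhds.add ((tendsto_coinTail k l).const_mul _))) hN
  have hcdf : poissonCdf k l ≤ 1 - errorRate k / 8 := poissonCdf_le_of_rate hk hlog hu
  have hmax : α * (2 * k - 1) ≤ 2 * k - k * errorRate k / 8 := by
    refine hlim.trans (max_le (by linarith) ?_)
    nlinarith
  -- This absorbs the -1 in 2k - 1: comparing with (1 - u/32)(2k - 1) requires ku/16 + u/32 ≥ 1.
  have hku : 16 ≤ k * errorRate k := by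
    refine le_of_sq_le_sq ?_ (by positivity)
    rw [mul_pow, pow_two (k : ℝ), mul_assoc, mul_errorRate_sq (by omega)]
    nlinarith
  by_contra hcon
  have := mul_lt_mul_of_pos_right (not_le.1 hcon) (show (0 : ℝ) < 2 * k - 1 by linarith)
  nlinarith

/-! ### Combining the bounds -/

/-- Any benchmark between Proph and ExAnte inherits both bounds, so the two cases need no separate
argument. -/
theorem guarantee_bounds {bench : Benchmark}
    (hlow : ∀ (k n m : ℕ) (G : TypeDist n m) (r : Fin m → ℝ), IsValuation r →
      prophValue k G r ≤ bench k G r)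
    (hup : ∀ (k n m : ℕ) (G : TypeDist n m) (r : Fin m → ℝ), IsValuation r →
      bench k G r ≤ exAnteValue k G r) :
    ∀ᶠ k in atTop,
      (1 / 32 * errorRate k ≤ 1 - stGuarantee bench k ∧
        1 - stGuarantee bench k ≤ 3 * errorRate k) ∧
      (1 / 32 * errorRate k ≤ 1 - ostGuarantee bench k ∧
        1 - ostGuarantee bench k ≤ 3 * errorRate k) := by
  filter_upwards [eventually_ge_atTop 4, eventually_le_log 64,
    tendsto_errorRate.eventually (gt_mem_nhds (by norm_num : (0 : ℝ) < 1 / 3))] with k hk hlog hu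
  have hu0 := errorRate_nonneg k
  have hinv := inv_le_errorRate (k := k) (by omega) (by linarith)
  have hinv0 : 0 ≤ 1 / (k : ℝ) := by positivity
  set α := 1 - 3 * errorRate k with hα
  have hα0 : 0 ≤ α := by linarith
  -- The product is at least 1 - 1/k - 2u, and 1/k ≤ u.
  have hα1 : α ≤ (1 - 1 / k) * (1 - 2 * errorRate k) := by nlinarith
  have hob : ∀ (n m : ℕ) (G : TypeDist n m), k < n →
      ∃ (J : Fin m) (ρ : ℝ), 0 < ρ ∧ ρ ≤ 1 ∧
        ∀ r : Fin m → ℝ, IsValuation r → α * bench k G r ≤ staticReward k G r J ρ := by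
    intro n m G hn
    obtain ⟨J, ρ, h0, h1, h⟩ := exists_oblivious_threshold (by omega) (by linarith) G hn
    refine ⟨J, ρ, h0, h1, fun r hr => le_trans ?_ (h r hr)⟩
    have hpos := (prophValue_nonneg k G r).trans (hlow k n m G r hr)
    exact mul_le_mul hα1 (hup k n m G r hr) hpos (hα0.trans hα1)
  have hst_of : ∀ β : ℝ, (∀ (n m : ℕ) (G : TypeDist n m), k < n →
      ∃ (J : Fin m) (ρ : ℝ), 0 < ρ ∧ ρ ≤ 1 ∧
        ∀ r : Fin m → ℝ, IsValuation r → β * bench k G r ≤ staticReward k G r J ρ) →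
      ∀ (n m : ℕ) (G : TypeDist n m) (r : Fin m → ℝ), k < n → IsValuation r →
        β * bench k G r ≤ stValue k G r := by
    intro β hβ n m G r hn hr
    obtain ⟨J, ρ, h0, h1, h⟩ := hβ n m G hn
    exact (h r hr).trans (staticReward_le_stValue k G hr.2 J h0 h1)
  have hst_le : ∀ β : ℝ, (∀ (n m : ℕ) (G : TypeDist n m) (r : Fin m → ℝ), k < n →
      IsValuation r → β * bench k G r ≤ stValue k G r) → β ≤ 1 - errorRate k / 32 := by
    intro β hβ
    rcases lt_or_ge β 0 with hneg | hpos
    · linarith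
    refine le_of_forall_prophValue_le_stValue hk hlog (by linarith) fun n m G r hn hr => ?_
    exact (mul_le_mul_of_nonneg_left (hlow k n m G r hr) hpos).trans (hβ n m G r hn hr)
  have hαle : α ≤ 1 := by linarith
  have hst1 : α ≤ stGuarantee bench k :=
    le_csSup ⟨1, fun β hβ => hβ.1⟩ ⟨hαle, hst_of α hob⟩
  have host1 : α ≤ ostGuarantee bench k := le_csSup ⟨1, fun β hβ => hβ.1⟩ ⟨hαle, hob⟩
  have hst2 : stGuarantee bench k ≤ 1 - errorRate k / 32 :=
    csSup_le ⟨α, hαle, hst_of α hob⟩ fun β hβ => hst_le β hβ.2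
  have host2 : ostGuarantee bench k ≤ 1 - errorRate k / 32 :=
    csSup_le ⟨α, hαle, hob⟩ fun β hβ => hst_le β (hst_of β hβ.2)
  refine ⟨⟨?_, ?_⟩, ?_, ?_⟩ <;> linarith

theorem mainTheorem4 :
    (∀ k : ℕ, 1 ≤ k → ∃! lam : ℝ≥0, poissonBelow k lam = poissonFill k lam) ∧
    (∀ lam : ℕ → ℝ≥0,
      (∀ k : ℕ, 1 ≤ k → poissonBelow k (lam k) = poissonFill k (lam k)) →
      (fun k : ℕ => 1 - poissonBelow k (lam k)) =Θ[atTop]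
          (fun k : ℕ => Real.sqrt (Real.log k / k)) ∧
      (fun k : ℕ => 1 - poissonFill k (lam k)) =Θ[atTop]
          (fun k : ℕ => Real.sqrt (Real.log k / k))) ∧
    (∀ bench : Benchmark, (bench = @prophValue ∨ bench = @exAnteValue) →
      (fun k : ℕ => 1 - stGuarantee bench k) =Θ[atTop]
          (fun k : ℕ => Real.sqrt (Real.log k / k)) ∧
      (fun k : ℕ => 1 - ostGuarantee bench k) =Θ[atTop]
          (fun k : ℕ => Real.sqrt (Real.log k / k))) := by
  refine ⟨fun k hk => existsUnique_poissonBelow_eq_poissonFill hk, fun lam hlam => ?_,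
    fun bench hbench => ?_⟩
  · have h := poissonBelow_bounds hlam
    have hB := isTheta_errorRate_of_bounds (by norm_num : (0 : ℝ) < 1 / 8)
      (h.mono fun k hk => hk.1) (h.mono fun k hk => hk.2)
    refine ⟨hB, IsTheta.trans (EventuallyEq.isTheta ?_) hB⟩
    filter_upwards [eventually_ge_atTop 1] with k hk
    rw [hlam k hk]
  · have h : ∀ᶠ k in atTop,
        (1 / 32 * errorRate k ≤ 1 - stGuarantee bench k ∧
          1 - stGuarantee bench k ≤ 3 * errorRate k) ∧
        (1 / 32 * errorRate k ≤ 1 - ostGuarantee bench k ∧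
          1 - ostGuarantee bench k ≤ 3 * errorRate k) := by
      rcases hbench with rfl | rfl
      · exact guarantee_bounds (fun _ _ _ _ _ _ => le_rfl)
          fun k _ _ G _ hr => prophValue_le_exAnteValue k G hr.2
      · exact guarantee_bounds (fun k _ _ G _ hr => prophValue_le_exAnteValue k G hr.2)
          fun _ _ _ _ _ _ => le_rfl
    have hc : (0 : ℝ) < 1 / 32 := by norm_num
    exact ⟨isTheta_errorRate_of_bounds hc (h.mono fun k hk => hk.1.1) (h.mono fun k hk => hk.1.2),
      isTheta_errorRate_of_bounds hc (h.mono fun k hk => hk.2.1) (h.mono fun k hk => hk.2.2)⟩
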